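/- **Proposition (Closed form optimal barrier in the dynamic spread model).** Let $T>0$, let $K\colon[0,T]\to(0,\infty)$ be twice continuously differentiable and let $\rho\colon[0,T]\to(0,\infty)$ be continuously differentiable (derivatives at the end points are one-sided). *Model.* For $t\in[0,T]$ and $x\ge 0$ let $\mathcal A_t(x)$ be the set of all nondecreasing, left-continuous functions $\Theta\colon[t,T+]\to[0,\infty)$ with $\Theta_t=0$ and $\Theta_{T+}=x$ (that is, a nondecreasing left-continuous function on $[t,T]$ together with a value $\Theta_{T+}\ge\Theta_T$), and put $\Delta\Theta_s=\Theta_{s+}-\Theta_s$. Let $d\Theta$ be the Lebesgue–Stieltjes measure on $[t,T]$ with distribution function $s\mapsto\Theta_{s+}$. For $\delta\ge0$ define $$D_s=\delta e^{-\int_t^s\rho_u\,du}+\int_{[t,s)}K_ue^{-\int_u^s\rho_r\,dr}\,d\Theta_u,\qquad J(t,\delta,\Theta)=\int_{[t,T]}\Big(D_s+\frac{K_s}{2}\Delta\Theta_s\Big)d\Theta_s,$$ $$U(t,\delta,x)=\inf_{\Theta\in\mathcal A_t(x)}J(t,\delta,\Theta).$$ The inner buy region at time $t$ is $$Br_t=\Big\{y>0:\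 \exists\,\xi\in(0,y),\ U(t,1,y)=U(t,1+K_t\xi,y-\xi)+\Big(1+\frac{K_t}{2}\xi\Big)\xi\Big\}.$$ A function $c\colon[0,T]\to[0,\infty]$ is the barrier function of $U$ if $Br_t=(c(t),\infty)$ for all $t\in[0,T]$, where $(\infty,\infty)=\emptyset$. *Assumptions.* Suppose $K'_t+2\rho_tK_t>0$ on $[0,T]$, put $$f_t=\frac{K'_t+\rho_tK_t}{K'_t+2\rho_tK_t},\qquad t\in[0,T],$$ and suppose $f_0\ge0$ and $f'_t+\rho_tf_t\ge0$ on $[0,T]$. *Conclusions.* (1) For all $t\in[0,T)$ we have $f_t\ge0$ and $\int_t^T\frac{f'_s+\rho_sf_s}{K_s}ds+\frac{1-f_T}{K_T}>0$. The value function $U$ has a barrier function, and it is given by $$c(t)=\frac1{f_t}\left(\int_t^T\frac{f'_s+\rho_sf_s}{K_s}\,ds+\frac{1-f_T}{K_T}\right)\in(0,\infty],\quad t\in[0,T),\qquad c(T)=0,$$ with $c(t)=\infty$ if $f_t=0$. (2) The constant $\bar c=\int_0^T\frac{f'_t+\rho_tf_t}{K_t}dt+\frac{f_0}{K_0}+\frac{1-f_T}{K_T}$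 is strictly positive. For any $x\in[0,\infty)$ and $\delta\in[0,x/c(0)]$ (with $x/\infty=0$), put $\delta^*=\frac1{\bar c}\big(x+\frac{\delta}{K_0}\big)$. Then there is a unique optimal strategy $\Theta^*\in\mathcal A_0(x)$ in the problem $U(0,\delta,x)$, and it is given by $$\Delta\Theta^*_0=\delta^*\frac{f_0}{K_0}-\frac{\delta}{K_0},\qquad d\Theta^*_t=\delta^*\frac{f'_t+\rho_tf_t}{K_t}\,dt\ \text{ on }(0,T),\qquad \Delta\Theta^*_T=\delta^*\frac{1-f_T}{K_T},$$ and $$U(0,\delta,x)=(\delta^*)^2\left(\int_0^T(K'_t+2\rho_tK_t)\frac{f_t^2}{2K_t^2}\,dt+\frac1{2K_T}\right)-\frac{\delta^2}{2K_0}.$$ -/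

import Mathlib

open Set MeasureTheory
open scoped ENNReal

noncomputable section

namespace OptimalExecution

/-- Deterministic pure purchasing strategies on `[t, T+]`: nondecreasing càglàd functions with
value `0` at time `t`. Such a function (the values on `[t, T]` and the extra value at `T+`) is
represented by its canonical extension to `ℝ`, equal to `0` to the left of `t` and equal to the
constant `Θ_{T+}` on `(T, ∞)`. Right limits exist by monotonicity. -/
@[ext]
structure Strategy (t T : ℝ) where
  toFun : ℝ → ℝ
  monotone' : Monotone toFun
  leftCts' : ∀ s, ContinuousWithinAt toFun (Iic s) s
  eq_zero' : ∀ s ≤ t, toFun s = 0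
  eq_final' : ∀ s, T < s → toFun s = Function.rightLim toFun T

namespace Strategy

variable {t T : ℝ}

instance : CoeFun (Strategy t T) (fun _ => ℝ → ℝ) := ⟨Strategy.toFun⟩

/-- `Θ_{T+}`, the total number of shares bought. -/
def final (Θ : Strategy t T) : ℝ := Function.rightLim Θ T

/-- `ΔΘ_s = Θ_{s+} - Θ_s`. -/
def jump (Θ : Strategy t T) (s : ℝ) : ℝ := Function.rightLim Θ s - Θ s

/-- The Lebesgue-Stieltjes measure `dΘ`, whose distribution function is `s ↦ Θ_{s+}`. -/
def measure (Θ : Strategy t T) : Measure ℝ := Θ.monotone'.stieltjesFunction.measure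

end Strategy

/-- The deviation `D_s = δ exp(-∫_t^s ρ) + ∫_{[t,s)} K_u exp(-∫_u^s ρ) dΘ_u`. -/
def deviation (K ρ : ℝ → ℝ) {t T : ℝ} (δ : ℝ) (Θ : Strategy t T) (s : ℝ) : ℝ :=
  δ * Real.exp (-∫ u in t..s, ρ u) +
    ∫ u in Ico t s, K u * Real.exp (-∫ r in u..s, ρ r) ∂Θ.measure

/-- The cost `J(t, δ, Θ) = ∫_{[t,T]} (D_s + K_s ΔΘ_s / 2) dΘ_s`. -/
def cost (K ρ : ℝ → ℝ) {t T : ℝ} (δ : ℝ) (Θ : Strategy t T) : ℝ :=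
  ∫ s in Icc t T, (deviation K ρ δ Θ s + K s / 2 * Θ.jump s) ∂Θ.measure

/-- The value function `U(t, δ, x)`: infimum of the cost over strategies with `Θ_{T+} = x`. -/
def valueFn (K ρ : ℝ → ℝ) (T t δ x : ℝ) : ℝ :=
  sInf {j | ∃ Θ : Strategy t T, Θ.final = x ∧ cost K ρ δ Θ = j}

/-- `Θ` is optimal in the problem `U(t, δ, x)`. -/
def IsOptimal (K ρ : ℝ → ℝ) {t T : ℝ} (δ x : ℝ) (Θ : Strategy t T) : Prop :=
  Θ.final = x ∧ ∀ Θ' : Strategy t T, Θ'.final = x → cost K ρ δ Θ ≤ cost K ρ δ Θ'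

/-- The inner buy region `Br_t`. -/
def innerBuyRegion (K ρ : ℝ → ℝ) (T t : ℝ) : Set ℝ :=
  {y | 0 < y ∧ ∃ ξ ∈ Ioo 0 y,
    valueFn K ρ T t 1 y = valueFn K ρ T t (1 + K t * ξ) (y - ξ) + (1 + K t / 2 * ξ) * ξ}

/-- `c : [0,T] → [0,∞]` is the barrier function of the value function (which thus has
wait-region/buy-region structure): `Br_t = (c(t), ∞)` for all `t ∈ [0,T]`, with
`(∞, ∞) = ∅`. -/
def IsBarrierFn (K ρ : ℝ → ℝ) (T : ℝ) (c : ℝ → ℝ≥0∞) : Prop :=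
  ∀ t ∈ Icc 0 T, innerBuyRegion K ρ T t = {y : ℝ | c t < ENNReal.ofReal y}

/-- The derivative on `[0,T]`, one-sided at the end points. -/
def dI (T : ℝ) (g : ℝ → ℝ) (t : ℝ) : ℝ := derivWithin g (Icc 0 T) t

/-- `f = (K' + ρ K) / (K' + 2 ρ K)`. -/
def fFn (K ρ : ℝ → ℝ) (T t : ℝ) : ℝ :=
  (dI T K t + ρ t * K t) / (dI T K t + 2 * ρ t * K t)

/-- `(f' + ρ f) / K`. -/
def rate (K ρ : ℝ → ℝ) (T t : ℝ) : ℝ :=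
  (dI T (fFn K ρ T) t + ρ t * fFn K ρ T t) / K t

/-- `∫_t^T (f'_s + ρ_s f_s) / K_s ds + (1 - f_T) / K_T`. -/
def barrierNum (K ρ : ℝ → ℝ) (T t : ℝ) : ℝ :=
  (∫ s in t..T, rate K ρ T s) + (1 - fFn K ρ T T) / K T

/-- The closed form barrier; the quotient is taken in `[0,∞]`, where `a / 0 = ∞` for `a > 0`. -/
def barrier (K ρ : ℝ → ℝ) (T t : ℝ) : ℝ≥0∞ :=
  if t < T then ENNReal.ofReal (barrierNum K ρ T t) / ENNReal.ofReal (fFn K ρ T t) else 0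

/-- The constant `∫_0^T (f' + ρ f) / K dt + f_0 / K_0 + (1 - f_T) / K_T`. -/
def normConst (K ρ : ℝ → ℝ) (T : ℝ) : ℝ :=
  (∫ t in (0 : ℝ)..T, rate K ρ T t) + fFn K ρ T 0 / K 0 + (1 - fFn K ρ T T) / K T

/-- `(x + δ / K_0)` divided by the constant above. -/
def deltaStar (K ρ : ℝ → ℝ) (T δ x : ℝ) : ℝ := 1 / normConst K ρ T * (x + δ / K 0)

end OptimalExecution

end

open OptimalExecution

/-!
Both parts of the result follow from rewriting the cost and the budget constraint in terms of the
deviation `D` instead of the strategy `Θ`. Since `dD = -ρ D ds + K dΘ`, integration by parts gives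

* `J(t, δ, Θ) = ½ (∫_t^T (K' + 2ρK) / K² * D² ds + D_{T+}² / K_T) - δ² / (2 K_t)`,
* `x + δ / K_t = ∫_t^T (K' + 2ρK) / K² * f D ds + D_{T+} / K_T`,

for every `Θ` with `Θ_{T+} = x` (`RegularMarket.cost_eq`, `RegularMarket.final_add_eq`). So the
problem is to minimize a squared Hilbert norm of `(D, D_{T+})` for a prescribed inner product with
`(f, 1)`. Completing the square (`RegularMarket.cost_eq_add_excess`), the cost is an explicit
constant plus half the squared distance (`excess`) from `(D, D_{T+})` to `δ* (f, 1)`, where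
`δ* = (x + δ / K_t) / c̄_t` and `c̄_t` is the squared norm of `(f, 1)`, computed in closed form in
`RegularMarket.totalConst_eq`. The distance vanishes for at most one strategy
(`RegularMarket.excess_eq_zero_unique`). The strategy with deviation `δ* f` has initial trade
`(δ* f_t - δ) / K_t`, rate `δ* (f' + ρ f) / K` and terminal trade `δ* (1 - f_T) / K_T`. The last two
are nonnegative by assumption, the first exactly when `δ ≤ δ* f_t`, that is, when `c(t) δ ≤ x`.
This proves the closed form of the optimum, at every initial time.

For the barrier, note that a trade `ξ` leaves `δ*` unchanged. Above the barrier the closed form of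
the value function holds before and after a small trade, so the trade is optimal
(`BuyingMarket.mem_innerBuyRegion`). Below or on the barrier the unconstrained optimum sells at the
initial time (or does not trade). Mixing it with any strategy that begins with a purchase `ξ` gives
an admissible strategy whose excess cost is smaller by a fixed factor `w² < 1`
(`BuyingMarket.excess_blend`). As the excess cost of the strategies that begin with `ξ` is bounded
away from zero (`RegularMarket.exists_pos_le_excess`), the purchase `ξ` is strictly suboptimal
(`BuyingMarket.not_mem_innerBuyRegion`). This argument needs neither the existence of optimal
strategies below the barrier nor finiteness of the barrier.

In the proofs the deviation is replaced by the monotone function `E_s = exp(∫_t^s ρ) D_s`.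
-/

/-! ### Fubini identities for finite measures on the line -/

/-- Integration by parts for a `C¹` function against a finite measure, as a consequence of Fubini's
theorem. -/
theorem integral_mul_eq_sub_integral_Iio {μ : Measure ℝ} [IsFiniteMeasure μ] {a b : ℝ}
    (hab : a ≤ b) (hμ : ∀ᵐ s ∂μ, s ∈ Icc a b) {φ φ' F : ℝ → ℝ}
    (hφ' : IntervalIntegrable φ' volume a b)
    (hφ : ∀ s ∈ Icc a b, φ s = φ b - ∫ r in s..b, φ' r) (hF : Integrable F μ) :
    ∫ s, φ s * F s ∂μ =
      φ b * ∫ s, F s ∂μ - ∫ r in a..b, φ' r * ∫ s in Iio r, F s ∂μ := by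
  have hφ'' : Integrable φ' (volume.restrict (Ioc a b)) :=
    (intervalIntegrable_iff_integrableOn_Ioc_of_le hab).1 hφ'
  have hS : MeasurableSet {p : ℝ × ℝ | p.1 < p.2} := measurableSet_lt measurable_fst measurable_snd
  have hprod : Integrable (fun p : ℝ × ℝ => {p : ℝ × ℝ | p.1 < p.2}.indicator
      (fun p => F p.1 * φ' p.2) p) (μ.prod (volume.restrict (Ioc a b))) :=
    (hF.mul_prod hφ'').indicator hS
  have h1 : ∫ s, φ s * F s ∂μ = ∫ s, (φ b * F s - ∫ r in Ioc a b,
      {p : ℝ × ℝ | p.1 < p.2}.indicator (fun p => F p.1 * φ' p.2) (s, r)) ∂μ := by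
    refine integral_congr_ae ?_
    filter_upwards [hμ] with s hs
    rw [hφ s hs, sub_mul, intervalIntegral.integral_of_le hs.2]
    congr 1
    have : (fun r => {p : ℝ × ℝ | p.1 < p.2}.indicator (fun p => F p.1 * φ' p.2) (s, r)) =
        (Ioi s).indicator (fun r => F s * φ' r) := by
      ext r; simp [indicator]
    rw [this, setIntegral_indicator measurableSet_Ioi, integral_const_mul, mul_comm]
    congr 3
    ext r
    simp only [mem_Ioc, mem_inter_iff, mem_Ioi]
    constructor
    · rintro ⟨h, h'⟩; exact ⟨⟨hs.1.trans_lt h, h'⟩, h⟩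
    · rintro ⟨⟨_, h⟩, h'⟩; exact ⟨h', h⟩
  rw [h1, integral_sub (hF.const_mul _) hprod.integral_prod_left, integral_const_mul,
    integral_integral_swap hprod, intervalIntegral.integral_of_le hab]
  congr 2
  ext r
  have : (fun s => {p : ℝ × ℝ | p.1 < p.2}.indicator (fun p => F p.1 * φ' p.2) (s, r)) =
      (Iio r).indicator (fun s => F s * φ' r) := by
    ext s; simp [indicator]
  rw [this, integral_indicator measurableSet_Iio, integral_mul_const, mul_comm]

/-- The change of variables `d(N²) = 2 N dN` for `N_s = ∫_{(-∞, s)} h dμ`, with the correction that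
the atoms of `μ` require. By symmetry the double integral of `h ⊗ h` over the open half-plane
`u < s` plus half the one over the diagonal is half the integral over the plane. -/
theorem integral_mul_integral_Iio_add_half_atom {μ : Measure ℝ} [IsFiniteMeasure μ] {h : ℝ → ℝ}
    (hh : Integrable h μ) :
    Integrable (fun s => h s * (∫ u in Iio s, h u ∂μ + h s * μ.real {s} / 2)) μ ∧
    ∫ s, h s * (∫ u in Iio s, h u ∂μ + h s * μ.real {s} / 2) ∂μ = (∫ s, h s ∂μ) ^ 2 / 2 := by
  have hA : MeasurableSet {p : ℝ × ℝ | p.2 < p.1} := measurableSet_lt measurable_snd measurable_fst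
  have hB : MeasurableSet {p : ℝ × ℝ | p.1 < p.2} := measurableSet_lt measurable_fst measurable_snd
  have hC : MeasurableSet {p : ℝ × ℝ | p.2 = p.1} :=
    measurableSet_eq_fun measurable_snd measurable_fst
  have hp : Integrable (fun p : ℝ × ℝ => h p.1 * h p.2) (μ.prod μ) := hh.mul_prod hh
  have eA : ∀ s, ∫ u, {p : ℝ × ℝ | p.2 < p.1}.indicator (fun p => h p.1 * h p.2) (s, u) ∂μ =
      h s * ∫ u in Iio s, h u ∂μ := fun s => by
    rw [← integral_const_mul, ← integral_indicator measurableSet_Iio]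
    congr 1
  have eB : ∀ s, ∫ u, {p : ℝ × ℝ | p.1 < p.2}.indicator (fun p => h p.1 * h p.2) (s, u) ∂μ =
      h s * ∫ u in Ioi s, h u ∂μ := fun s => by
    rw [← integral_const_mul, ← integral_indicator measurableSet_Ioi]
    congr 1
  have eC : ∀ s, ∫ u, {p : ℝ × ℝ | p.2 = p.1}.indicator (fun p => h p.1 * h p.2) (s, u) ∂μ =
      h s * (h s * μ.real {s}) := fun s => by
    have : ∫ u in {s}, h u ∂μ = h s * μ.real {s} := by
      rw [integral_singleton, smul_eq_mul, mul_comm]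
    rw [← this, ← integral_const_mul, ← integral_indicator (measurableSet_singleton s)]
    congr 1
  have iA := (hp.indicator hA).integral_prod_left
  have iB := (hp.indicator hB).integral_prod_left
  have iC := (hp.indicator hC).integral_prod_left
  simp only [eA] at iA
  simp only [eB] at iB
  simp only [eC] at iC
  have hswap : ∫ s, h s * ∫ u in Iio s, h u ∂μ ∂μ = ∫ s, h s * ∫ u in Ioi s, h u ∂μ ∂μ := by
    simp only [← eA, ← eB]
    refine (integral_integral_swap (f := fun s u => {p : ℝ × ℝ | p.2 < p.1}.indicator
      (fun p => h p.1 * h p.2) (s, u)) (hp.indicator hA)).trans ?_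
    congr 1; ext s; congr 1; ext u
    simp [indicator, mul_comm]
  have hsum : ∀ s, ∫ u, h u ∂μ =
      ∫ u in Iio s, h u ∂μ + h s * μ.real {s} + ∫ u in Ioi s, h u ∂μ := fun s => by
    rw [← integral_add_compl (measurableSet_Iic (a := s)) hh, compl_Iic, ← Iio_union_right,
      setIntegral_union (by simp) (measurableSet_singleton s) hh.integrableOn hh.integrableOn,
      integral_singleton, smul_eq_mul, mul_comm (h s)]
  have htot : (∫ s, h s ∂μ) ^ 2 = ∫ s, h s * ∫ u in Iio s, h u ∂μ ∂μ +
      ∫ s, h s * (h s * μ.real {s}) ∂μ + ∫ s, h s * ∫ u in Ioi s, h u ∂μ ∂μ := by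
    rw [← integral_add iA iC, ← integral_add (iA.fun_add iC) iB, sq, ← integral_mul_const]
    congr 1; ext s
    rw [hsum s]
    ring
  have hrew : (fun s => h s * (∫ u in Iio s, h u ∂μ + h s * μ.real {s} / 2)) =
      fun s => h s * ∫ u in Iio s, h u ∂μ + (1 / 2) * (h s * (h s * μ.real {s})) := by
    ext s; ring
  rw [hrew]
  refine ⟨iA.add (iC.const_mul _), ?_⟩
  rw [integral_add iA (iC.const_mul _), integral_const_mul, htot, ← hswap]
  ring

namespace OptimalExecution

open Filter Topology

/-! ### Functions with a continuous derivative on a compact interval -/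

/-- `φ` is continuous on `[a, b]` and differentiable on `(a, b)`, with derivative `φ'` that is
continuous on the whole of `[a, b]`. -/
structure HasContDerivOn (φ φ' : ℝ → ℝ) (a b : ℝ) : Prop where
  continuousOn : ContinuousOn φ (Icc a b)
  hasDerivAt : ∀ s ∈ Ioo a b, HasDerivAt φ (φ' s) s
  continuousOn_deriv : ContinuousOn φ' (Icc a b)

namespace HasContDerivOn

variable {φ φ' χ χ' : ℝ → ℝ} {a b : ℝ}

theorem mono (h : HasContDerivOn φ φ' a b) {c d : ℝ} (hc : a ≤ c) (hd : d ≤ b) :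
    HasContDerivOn φ φ' c d :=
  ⟨h.continuousOn.mono (Icc_subset_Icc hc hd),
    fun s hs => h.hasDerivAt s ⟨hc.trans_lt hs.1, hs.2.trans_le hd⟩,
    h.continuousOn_deriv.mono (Icc_subset_Icc hc hd)⟩

theorem intervalIntegrable (h : HasContDerivOn φ φ' a b) (hab : a ≤ b) :
    IntervalIntegrable φ' volume a b :=
  h.continuousOn_deriv.intervalIntegrable_of_Icc hab

theorem integral_eq (h : HasContDerivOn φ φ' a b) (hab : a ≤ b) :
    ∫ r in a..b, φ' r = φ b - φ a :=
  intervalIntegral.integral_eq_sub_of_hasDerivAt_of_le hab h.continuousOn h.hasDerivAt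
    (h.intervalIntegrable hab)

theorem mul (h : HasContDerivOn φ φ' a b) (k : HasContDerivOn χ χ' a b) :
    HasContDerivOn (fun s => φ s * χ s) (fun s => φ' s * χ s + φ s * χ' s) a b :=
  ⟨h.continuousOn.mul k.continuousOn, fun s hs => (h.hasDerivAt s hs).mul (k.hasDerivAt s hs),
    (h.continuousOn_deriv.mul k.continuousOn).add (h.continuousOn.mul k.continuousOn_deriv)⟩

theorem congr_deriv (h : HasContDerivOn φ φ' a b) (he : ∀ s ∈ Icc a b, φ' s = χ' s) :
    HasContDerivOn φ χ' a b :=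
  ⟨h.continuousOn, fun s hs => he s (Ioo_subset_Icc_self hs) ▸ h.hasDerivAt s hs,
    h.continuousOn_deriv.congr fun s hs => (he s hs).symm⟩

theorem exp (h : HasContDerivOn φ φ' a b) :
    HasContDerivOn (fun s => Real.exp (φ s)) (fun s => Real.exp (φ s) * φ' s) a b :=
  ⟨h.continuousOn.rexp, fun s hs => (h.hasDerivAt s hs).exp,
    h.continuousOn.rexp.mul h.continuousOn_deriv⟩

theorem neg (h : HasContDerivOn φ φ' a b) :
    HasContDerivOn (fun s => -φ s) (fun s => -φ' s) a b :=
  ⟨h.continuousOn.neg, fun s hs => (h.hasDerivAt s hs).neg, h.continuousOn_deriv.neg⟩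

theorem inv (h : HasContDerivOn φ φ' a b) (h0 : ∀ s ∈ Icc a b, φ s ≠ 0) :
    HasContDerivOn (fun s => (φ s)⁻¹) (fun s => -φ' s / φ s ^ 2) a b :=
  ⟨h.continuousOn.inv₀ h0,
    fun s hs => (h.hasDerivAt s hs).inv (h0 s (Ioo_subset_Icc_self hs)),
    h.continuousOn_deriv.neg.div (h.continuousOn.pow 2) fun s hs => pow_ne_zero 2 (h0 s hs)⟩

theorem primitive {g : ℝ → ℝ} (hg : ContinuousOn g (Icc a b)) (hab : a ≤ b) :
    HasContDerivOn (fun s => ∫ u in a..s, g u) g a b where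
  continuousOn := by
    have := intervalIntegral.continuousOn_primitive_interval'
      (hg.intervalIntegrable_of_Icc (μ := volume) hab) left_mem_uIcc
    rwa [uIcc_of_le hab] at this
  hasDerivAt s hs := by
    refine intervalIntegral.integral_hasDerivAt_right
      ((hg.mono (Icc_subset_Icc le_rfl hs.2.le)).intervalIntegrable_of_Icc hs.1.le)
      ((hg.mono Ioo_subset_Icc_self).stronglyMeasurableAtFilter isOpen_Ioo s hs)
      (hg.continuousAt (Icc_mem_nhds hs.1 hs.2))
  continuousOn_deriv := hg

end HasContDerivOn

/-! ### The Lebesgue-Stieltjes measure of a strategy -/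

namespace Strategy

variable {t T : ℝ}

theorem leftLim_eq (Θ : Strategy t T) (s : ℝ) : Function.leftLim Θ s = Θ s :=
  ContinuousWithinAt.leftLim_eq (f := Θ.toFun) (Θ.leftCts' s)

theorem leftLim_stieltjesFunction (Θ : Strategy t T) (s : ℝ) :
    Function.leftLim Θ.monotone'.stieltjesFunction s = Θ s := by
  have : (Θ.monotone'.stieltjesFunction : ℝ → ℝ) = Function.rightLim Θ := by
    ext x; exact Θ.monotone'.stieltjesFunction_eq x
  rw [this, leftLim_rightLim (Θ.monotone'.tendsto_leftLim s), Θ.leftLim_eq]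

theorem rightLim_eq_of_forall_gt {F : ℝ → ℝ} {a c : ℝ} (h : ∀ s, a < s → F s = c) :
    Function.rightLim F a = c :=
  rightLim_eq_of_tendsto
    (tendsto_const_nhds.congr' <| eventually_mem_nhdsWithin.mono fun s hs => (h s hs).symm)

theorem jump_nonneg (Θ : Strategy t T) (s : ℝ) : 0 ≤ Θ.jump s :=
  sub_nonneg.2 (Θ.monotone'.le_rightLim le_rfl)

theorem nonneg (Θ : Strategy t T) (s : ℝ) : 0 ≤ Θ s := by
  rcases le_total s t with h | h
  · exact (Θ.eq_zero' s h).ge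
  · exact (Θ.eq_zero' t le_rfl).ge.trans (Θ.monotone' h)

theorem final_nonneg (Θ : Strategy t T) : 0 ≤ Θ.final :=
  (Θ.nonneg T).trans (Θ.monotone'.le_rightLim le_rfl)

theorem measureReal_singleton (Θ : Strategy t T) (s : ℝ) : Θ.measure.real {s} = Θ.jump s := by
  rw [measureReal_def, measure, StieltjesFunction.measure_singleton, leftLim_stieltjesFunction,
    Θ.monotone'.stieltjesFunction_eq, ← jump, ENNReal.toReal_ofReal (Θ.jump_nonneg s)]

theorem tendsto_atBot (Θ : Strategy t T) :
    Tendsto Θ.monotone'.stieltjesFunction atBot (𝓝 0) := by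
  refine tendsto_const_nhds.congr' ((eventually_lt_atBot t).mono fun s hs => ?_)
  rw [Θ.monotone'.stieltjesFunction_eq]
  symm
  refine le_antisymm ?_ ((Θ.nonneg s).trans (Θ.monotone'.le_rightLim le_rfl))
  exact (Θ.monotone'.rightLim_le hs).trans (Θ.eq_zero' t le_rfl).le

theorem tendsto_atTop (Θ : Strategy t T) :
    Tendsto Θ.monotone'.stieltjesFunction atTop (𝓝 Θ.final) := by
  refine tendsto_const_nhds.congr' ((eventually_gt_atTop T).mono fun s hs => ?_)
  rw [Θ.monotone'.stieltjesFunction_eq]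
  symm
  exact rightLim_eq_of_forall_gt fun u hu => Θ.eq_final' u (hs.trans hu)

theorem measure_Iio (Θ : Strategy t T) (s : ℝ) : Θ.measure (Iio s) = ENNReal.ofReal (Θ s) := by
  rw [measure, StieltjesFunction.measure_Iio _ Θ.tendsto_atBot, leftLim_stieltjesFunction,
    sub_zero]

theorem measure_univ (Θ : Strategy t T) : Θ.measure univ = ENNReal.ofReal Θ.final := by
  rw [measure, StieltjesFunction.measure_univ _ Θ.tendsto_atBot Θ.tendsto_atTop, sub_zero]

instance (Θ : Strategy t T) : IsFiniteMeasure Θ.measure :=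
  ⟨by rw [measure_univ]; exact ENNReal.ofReal_lt_top⟩

theorem measureReal_Iio (Θ : Strategy t T) (s : ℝ) : Θ.measure.real (Iio s) = Θ s := by
  rw [measureReal_def, measure_Iio, ENNReal.toReal_ofReal (Θ.nonneg s)]

theorem measureReal_univ (Θ : Strategy t T) : Θ.measure.real univ = Θ.final := by
  rw [measureReal_def, measure_univ, ENNReal.toReal_ofReal Θ.final_nonneg]

theorem ae_mem_Icc (Θ : Strategy t T) : ∀ᵐ s ∂Θ.measure, s ∈ Icc t T := by
  have h1 : Θ.measure (Iio t) = 0 := by rw [measure_Iio, Θ.eq_zero' t le_rfl, ENNReal.ofReal_zero]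
  have h2 : Θ.measure (Ioi T) = 0 := by
    rw [measure, StieltjesFunction.measure_Ioi _ Θ.tendsto_atTop, Θ.monotone'.stieltjesFunction_eq,
      final, sub_self, ENNReal.ofReal_zero]
  rw [ae_iff]
  refine measure_mono_null (fun s hs => ?_) (measure_union_null h1 h2)
  simp only [mem_Icc, not_and_or, not_le, mem_ofPred_eq] at hs
  exact hs

theorem restrict_Icc (Θ : Strategy t T) : Θ.measure.restrict (Icc t T) = Θ.measure :=
  Measure.restrict_eq_self_of_ae_mem Θ.ae_mem_Icc

theorem setIntegral_Ico (Θ : Strategy t T) (F : ℝ → ℝ) (s : ℝ) :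
    ∫ u in Ico t s, F u ∂Θ.measure = ∫ u in Iio s, F u ∂Θ.measure := by
  refine setIntegral_congr_set ?_
  filter_upwards [Θ.ae_mem_Icc] with u hu
  exact propext ⟨fun h => h.2, fun h => ⟨hu.1, h⟩⟩

theorem integrable_of_continuousOn (Θ : Strategy t T) {h : ℝ → ℝ} (hh : ContinuousOn h (Icc t T)) :
    Integrable h Θ.measure := by
  rw [← Θ.restrict_Icc]
  exact hh.integrableOn_compact isCompact_Icc

theorem ext_of_final_eq {Θ Θ' : Strategy t T} (hf : Θ.final = Θ'.final)
    (h : ∀ s ∈ Ioc t T, Θ s = Θ' s) : Θ = Θ' := by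
  ext s
  rcases le_or_gt s t with hs | hs
  · rw [Θ.eq_zero' s hs, Θ'.eq_zero' s hs]
  rcases le_or_gt s T with hs' | hs'
  · exact h s ⟨hs, hs'⟩
  · rw [Θ.eq_final' s hs', Θ'.eq_final' s hs']; exact hf

/-- Left-continuity upgrades almost everywhere equality to equality. -/
theorem ext_of_ae_eq {Θ Θ' : Strategy t T} (hf : Θ.final = Θ'.final)
    (h : ∀ᵐ s, s ∈ Ioc t T → Θ s = Θ' s) : Θ = Θ' := by
  refine ext_of_final_eq hf fun s hs => ?_
  have hfreq : ∃ᶠ u in 𝓝[<] s, Θ u - Θ' u = 0 := by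
    rw [frequently_iff]
    intro U hU
    obtain ⟨l, hl, hlU⟩ := (mem_nhdsLT_iff_exists_Ioo_subset' hs.1).1 hU
    have hlt : max l t < s := max_lt hl hs.1
    -- otherwise the two functions would differ on the whole interval `(max l t, s)`
    by_contra! hcon
    have : volume (Ioo (max l t) s) = 0 := by
      refine measure_mono_null (fun u hu => ?_) h
      have h1 : u ∈ Ioc t T := ⟨(le_max_right _ _).trans_lt hu.1, hu.2.le.trans hs.2⟩
      have h2 : u ∈ U := hlU ⟨(le_max_left _ _).trans_lt hu.1, hu.2⟩
      simp only [mem_compl_iff, mem_ofPred_eq, Classical.not_imp]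
      exact ⟨h1, fun he => hcon u h2 (by rw [he, sub_self])⟩
    rw [Real.volume_Ioo, ENNReal.ofReal_eq_zero] at this
    linarith
  have hlim : Tendsto (fun u => Θ u - Θ' u) (𝓝[<] s) (𝓝 (Θ s - Θ' s)) :=
    ((Θ.leftCts' s).mono Iio_subset_Iic_self).sub ((Θ'.leftCts' s).mono Iio_subset_Iic_self)
  have : Θ s - Θ' s ∈ ({0} : Set ℝ) := isClosed_singleton.mem_of_frequently_of_tendsto hfreq hlim
  exact sub_eq_zero.1 this

section ByParts

variable {φ φ' : ℝ → ℝ}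

theorem integral_mul_eq (Θ : Strategy t T) (htT : t ≤ T) (hφ : HasContDerivOn φ φ' t T)
    {F : ℝ → ℝ} (hF : Integrable F Θ.measure) :
    ∫ s, φ s * F s ∂Θ.measure =
      φ T * ∫ s, F s ∂Θ.measure - ∫ r in t..T, φ' r * ∫ s in Iio r, F s ∂Θ.measure := by
  refine integral_mul_eq_sub_integral_Iio htT Θ.ae_mem_Icc (hφ.intervalIntegrable htT)
    (fun s hs => ?_) hF
  rw [(hφ.mono hs.1 le_rfl).integral_eq hs.2]; ring

theorem setIntegral_Iio_mul_eq (Θ : Strategy t T) (hφ : HasContDerivOn φ φ' t T)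
    {F : ℝ → ℝ} (hF : Integrable F Θ.measure) {b : ℝ} (hb : b ∈ Icc t T) :
    ∫ s in Iio b, φ s * F s ∂Θ.measure =
      φ b * ∫ s in Iio b, F s ∂Θ.measure - ∫ r in t..b, φ' r * ∫ s in Iio r, F s ∂Θ.measure := by
  have hae : ∀ᵐ s ∂Θ.measure.restrict (Iio b), s ∈ Icc t b := by
    filter_upwards [ae_restrict_of_ae Θ.ae_mem_Icc, ae_restrict_mem measurableSet_Iio] with s h1 h2
    exact ⟨h1.1, h2.le⟩
  have hφb := hφ.mono le_rfl hb.2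
  rw [integral_mul_eq_sub_integral_Iio hb.1 hae (hφb.intervalIntegrable hb.1)
    (fun s hs => ?_) hF.restrict]
  · congr 1
    refine intervalIntegral.integral_congr fun r hr => ?_
    rw [uIcc_of_le hb.1] at hr
    rw [Measure.restrict_restrict measurableSet_Iio, Iio_inter_Iio, min_eq_left hr.2]
  · rw [(hφb.mono hs.1 le_rfl).integral_eq hs.2]; ring

theorem integral_eq (Θ : Strategy t T) (htT : t ≤ T) (hφ : HasContDerivOn φ φ' t T) :
    ∫ s, φ s ∂Θ.measure = φ T * Θ.final - ∫ r in t..T, φ' r * Θ r := by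
  have := Θ.integral_mul_eq htT hφ (F := fun _ => 1) (integrable_const _)
  simpa [measureReal_univ, measureReal_Iio] using this

theorem setIntegral_Iio_eq (Θ : Strategy t T) (hφ : HasContDerivOn φ φ' t T)
    {b : ℝ} (hb : b ∈ Icc t T) :
    ∫ s in Iio b, φ s ∂Θ.measure = φ b * Θ b - ∫ r in t..b, φ' r * Θ r := by
  have := Θ.setIntegral_Iio_mul_eq hφ (F := fun _ => 1) (integrable_const _) hb
  simpa [measureReal_univ, measureReal_Iio] using this

end ByParts

/-! ### Combinations of strategies -/

section Combination

theorem continuousWithinAt_ite_lt (a c s : ℝ) :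
    ContinuousWithinAt (fun u => if a < u then c else (0 : ℝ)) (Iic s) s := by
  rcases le_or_gt s a with h | h
  · refine (continuousWithinAt_const (b := (0 : ℝ))).congr (fun u hu => ?_) ?_
    · rw [if_neg (not_lt.2 (le_trans hu h))]
    · rw [if_neg (not_lt.2 h)]
  · refine ((continuousAt_const (y := c)).congr ?_).continuousWithinAt
    filter_upwards [lt_mem_nhds h] with u hu
    rw [if_pos hu]

theorem monotone_ite_lt (a : ℝ) {c : ℝ} (hc : 0 ≤ c) :
    Monotone (fun u => if a < u then c else (0 : ℝ)) := by
  intro u v huv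
  dsimp only
  split_ifs with h1 h2
  · exact le_rfl
  · exact absurd (h1.trans_le huv) h2
  · exact hc
  · exact le_rfl

variable {g : ℝ → ℝ}

theorem continuous_integral_clamp (htT : t ≤ T) (hg : ContinuousOn g (Icc t T)) :
    Continuous fun s => ∫ u in t..max t (min s T), g u :=
  (HasContDerivOn.primitive hg htT).continuousOn.comp_continuous
    (by fun_prop) fun s => ⟨le_max_left _ _, max_le htT (min_le_right _ _)⟩

theorem monotone_integral_clamp (htT : t ≤ T) (hg : ContinuousOn g (Icc t T))
    (hg0 : ∀ s ∈ Icc t T, 0 ≤ g s) :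
    Monotone fun s => ∫ u in t..max t (min s T), g u := by
  intro u v huv
  have hle : max t (min u T) ≤ max t (min v T) := max_le_max le_rfl (min_le_min huv le_rfl)
  have hv : max t (min v T) ≤ T := max_le htT (min_le_right _ _)
  refine intervalIntegral.integral_mono_interval le_rfl (le_max_left _ _) hle ?_
    ((hg.mono (Icc_subset_Icc le_rfl hv)).intervalIntegrable_of_Icc (le_max_left _ _))
  filter_upwards [ae_restrict_mem measurableSet_Ioc] with s hs
  exact hg0 s ⟨hs.1.le, hs.2.trans hv⟩

/-- The strategy that trades `w` times as much as `Θ` and, on top of it, buys `b` shares at the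
initial time, buys at the rate `q * g` on `(t, T)`, and buys `p` shares at the terminal time. -/
noncomputable def combine (Θ : Strategy t T) (htT : t ≤ T) (hg : ContinuousOn g (Icc t T))
    (hg0 : ∀ s ∈ Icc t T, 0 ≤ g s) {w b q p : ℝ} (hw : 0 ≤ w) (hb : 0 ≤ b) (hq : 0 ≤ q)
    (hp : 0 ≤ p) : Strategy t T where
  toFun s := w * Θ s + (if t < s then b else 0) + q * (∫ u in t..max t (min s T), g u) +
    (if T < s then p else 0)
  monotone' := (((Θ.monotone'.const_mul hw).add (monotone_ite_lt t hb)).add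
    ((monotone_integral_clamp htT hg hg0).const_mul hq)).add (monotone_ite_lt T hp)
  leftCts' s := (((continuousWithinAt_const.mul (Θ.leftCts' s)).add
    (continuousWithinAt_ite_lt t b s)).add (continuousWithinAt_const.mul
      (continuous_integral_clamp htT hg).continuousWithinAt)).add (continuousWithinAt_ite_lt T p s)
  eq_zero' s hs := by
    simp [Θ.eq_zero' s hs, not_lt.2 hs, not_lt.2 (hs.trans htT), hs.trans htT, hs]
  eq_final' s hs := by
    refine (rightLim_eq_of_forall_gt fun u hu => ?_).symm
    simp only [Θ.eq_final' u hu, Θ.eq_final' s hs, if_pos (htT.trans_lt hu), if_pos hu,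
      if_pos (htT.trans_lt hs), if_pos hs, min_eq_right hu.le, min_eq_right hs.le]

variable (Θ : Strategy t T) (htT : t ≤ T) (hg : ContinuousOn g (Icc t T))
    (hg0 : ∀ s ∈ Icc t T, 0 ≤ g s) {w b q p : ℝ} (hw : 0 ≤ w) (hb : 0 ≤ b) (hq : 0 ≤ q)
    (hp : 0 ≤ p)

theorem combine_apply {s : ℝ} (hs : s ∈ Ioc t T) :
    Θ.combine htT hg hg0 hw hb hq hp s = w * Θ s + b + q * ∫ u in t..s, g u := by
  simp [combine, hs.1, not_lt.2 hs.2, min_eq_left hs.2, max_eq_right hs.1.le]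

theorem combine_final :
    (Θ.combine htT hg hg0 hw hb hq hp).final = w * Θ.final + b + q * (∫ u in t..T, g u) + p := by
  refine rightLim_eq_of_forall_gt fun u hu => ?_
  simp [combine, htT.trans_lt hu, hu, min_eq_right hu.le, max_eq_right htT, final,
    Θ.eq_final' u hu]

theorem rightLim_combine_zero (htT' : t < T) (hΘ : w = 0) :
    Function.rightLim (Θ.combine htT hg hg0 hw hb hq hp) t = b := by
  refine rightLim_eq_of_tendsto ?_
  have h1 : Tendsto (fun s => b + q * ∫ u in t..max t (min s T), g u) (𝓝[>] t) (𝓝 b) := by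
    have := ((continuous_integral_clamp htT hg).const_mul q).const_add b |>.tendsto t
    simp only [min_eq_left htT, max_self, intervalIntegral.integral_same, mul_zero,
      add_zero] at this
    exact this.mono_left nhdsWithin_le_nhds
  refine h1.congr' ?_
  filter_upwards [Ioc_mem_nhdsGT htT'] with s hs
  rw [combine_apply _ _ _ _ _ _ _ _ hs, hΘ, min_eq_left hs.2, max_eq_right hs.1.le, zero_mul,
    zero_add]

variable {h h' : ℝ → ℝ}

theorem intervalIntegrable_mul (hh : ContinuousOn h (Icc t T)) {s : ℝ} (hs : s ∈ Icc t T) :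
    IntervalIntegrable (fun r => h r * Θ r) volume t s :=
  Θ.monotone'.intervalIntegrable.continuousOn_mul
    (by rw [uIcc_of_le hs.1]; exact hh.mono (Icc_subset_Icc le_rfl hs.2))

/-- Integration by parts turns integrals against the measure of a strategy into Lebesgue integrals
of the strategy itself, so that integrals against the measure of a combination can be computed
without identifying this measure. -/
theorem integral_deriv_mul_combine (hh : HasContDerivOn h h' t T) {s : ℝ} (hs : s ∈ Icc t T) :
    ∫ r in t..s, h' r * Θ.combine htT hg hg0 hw hb hq hp r =
      w * (∫ r in t..s, h' r * Θ r) + b * (h s - h t) +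
        q * (h s * (∫ u in t..s, g u) - ∫ u in t..s, h u * g u) := by
  have hh' := hh.mono le_rfl hs.2
  have hP := HasContDerivOn.primitive (hg.mono (Icc_subset_Icc le_rfl hs.2)) hs.1
  have hprod := (hh'.mul hP).integral_eq hs.1
  have i1 : IntervalIntegrable (fun r => h' r * ∫ u in t..r, g u) volume t s :=
    (hh'.continuousOn_deriv.mul hP.continuousOn).intervalIntegrable_of_Icc hs.1
  have i2 : IntervalIntegrable (fun r => h r * g r) volume t s :=
    (hh'.continuousOn.mul hP.continuousOn_deriv).intervalIntegrable_of_Icc hs.1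
  rw [intervalIntegral.integral_add i1 i2, intervalIntegral.integral_same] at hprod
  have i3 := Θ.intervalIntegrable_mul hh.continuousOn_deriv hs
  have i4 := hh'.intervalIntegrable hs.1
  have : ∫ r in t..s, h' r * Θ.combine htT hg hg0 hw hb hq hp r =
      ∫ r in t..s, (w * (h' r * Θ r) + b * h' r + q * (h' r * ∫ u in t..r, g u)) := by
    refine intervalIntegral.integral_congr_ae (ae_of_all _ fun r hr => ?_)
    rw [uIoc_of_le hs.1] at hr
    rw [combine_apply _ _ _ _ _ _ _ _ ⟨hr.1, hr.2.trans hs.2⟩]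
    ring
  rw [this, intervalIntegral.integral_add ((i3.const_mul w).add (i4.const_mul b)) (i1.const_mul q),
    intervalIntegral.integral_add (i3.const_mul w) (i4.const_mul b),
    intervalIntegral.integral_const_mul, intervalIntegral.integral_const_mul,
    intervalIntegral.integral_const_mul, hh'.integral_eq hs.1]
  linear_combination q * hprod

theorem setIntegral_Iio_combine (hh : HasContDerivOn h h' t T) {s : ℝ} (hs : s ∈ Ioc t T) :
    ∫ u in Iio s, h u ∂(Θ.combine htT hg hg0 hw hb hq hp).measure =
      w * (∫ u in Iio s, h u ∂Θ.measure) + b * h t + q * ∫ u in t..s, h u * g u := by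
  rw [setIntegral_Iio_eq _ hh (Ioc_subset_Icc_self hs), setIntegral_Iio_eq _ hh
    (Ioc_subset_Icc_self hs), integral_deriv_mul_combine _ _ _ _ _ _ _ _ hh
    (Ioc_subset_Icc_self hs), combine_apply _ _ _ _ _ _ _ _ hs]
  ring

theorem integral_combine (hh : HasContDerivOn h h' t T) :
    ∫ u, h u ∂(Θ.combine htT hg hg0 hw hb hq hp).measure =
      w * (∫ u, h u ∂Θ.measure) + b * h t + q * (∫ u in t..T, h u * g u) + p * h T := by
  rw [integral_eq _ htT hh, integral_eq _ htT hh, integral_deriv_mul_combine _ _ _ _ _ _ _ _ hh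
    (right_mem_Icc.2 htT), combine_final]
  ring

end Combination

/-- The strategy that never trades. -/
instance : Zero (Strategy t T) where
  zero :=
    { toFun := 0
      monotone' := monotone_const
      leftCts' := fun _ => continuousWithinAt_const
      eq_zero' := fun _ _ => rfl
      eq_final' := fun _ _ => (rightLim_eq_of_forall_gt fun _ _ => rfl).symm }

end Strategy

/-! ### The market and the compounded deviation -/

/-- The regularity and positivity assumptions on the price impact `K` and the resilience `ρ`. -/
structure RegularMarket (K ρ : ℝ → ℝ) (T : ℝ) : Prop where
  pos : 0 < T
  K_pos : ∀ t ∈ Icc 0 T, 0 < K t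
  ρ_pos : ∀ t ∈ Icc 0 T, 0 < ρ t
  contDiffOn_K : ContDiffOn ℝ 2 K (Icc 0 T)
  contDiffOn_ρ : ContDiffOn ℝ 1 ρ (Icc 0 T)
  denom_pos : ∀ t ∈ Icc 0 T, 0 < dI T K t + 2 * ρ t * K t

/-- `K_s exp(∫_t^s ρ)`: the impact at time `s` of a unit trade, compounded back to time `t`. -/
noncomputable def impact (K ρ : ℝ → ℝ) (t s : ℝ) : ℝ := K s * Real.exp (∫ u in t..s, ρ u)

/-- The density `(K' + 2ρK) exp(-2∫_t^s ρ) / K²` of the running cost with respect to the squared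
compounded deviation; it is minus the derivative of `exp(-2∫_t^s ρ) / K`. -/
noncomputable def costWeight (K ρ : ℝ → ℝ) (T t s : ℝ) : ℝ :=
  (dI T K s + 2 * ρ s * K s) / K s ^ 2 * Real.exp (-(2 * ∫ u in t..s, ρ u))

/-- `exp(∫_t^s ρ) f_s`, the shape of the optimal compounded deviation. -/
noncomputable def profile (K ρ : ℝ → ℝ) (T t s : ℝ) : ℝ :=
  Real.exp (∫ u in t..s, ρ u) * fFn K ρ T s

/-- The compounded deviation `exp(∫_t^s ρ) D_s = δ + ∫_{[t,s)} K_u exp(∫_t^u ρ) dΘ_u`. -/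
noncomputable def compDev (K ρ : ℝ → ℝ) {t T : ℝ} (δ : ℝ) (Θ : Strategy t T) (s : ℝ) : ℝ :=
  δ + ∫ u in Iio s, impact K ρ t u ∂Θ.measure

/-- The compounded deviation after the last trade, `exp(∫_t^T ρ) D_{T+}`. -/
noncomputable def compDevFinal (K ρ : ℝ → ℝ) {t T : ℝ} (δ : ℝ) (Θ : Strategy t T) : ℝ :=
  δ + ∫ u, impact K ρ t u ∂Θ.measure

/-- The constant `∫_t^T (f' + ρ f) / K ds + (1 - f_T) / K_T + f_t / K_t`. -/
noncomputable def totalConst (K ρ : ℝ → ℝ) (T t : ℝ) : ℝ :=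
  barrierNum K ρ T t + fFn K ρ T t / K t

/-- The squared distance, in the norm that measures the cost, between the compounded deviation of
a strategy and the multiple `d` of the optimal shape. -/
noncomputable def excess (K ρ : ℝ → ℝ) {t T : ℝ} (δ : ℝ) (Θ : Strategy t T) (d : ℝ) : ℝ :=
  (∫ r in t..T, costWeight K ρ T t r * (compDev K ρ δ Θ r - d * profile K ρ T t r) ^ 2) +
    Real.exp (-(2 * ∫ u in t..T, ρ u)) / K T *
      (compDevFinal K ρ δ Θ - d * Real.exp (∫ u in t..T, ρ u)) ^ 2

theorem hasContDerivOn_dI {T : ℝ} (hT : 0 < T) {g : ℝ → ℝ} (hg : ContDiffOn ℝ 1 g (Icc 0 T)) :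
    HasContDerivOn g (dI T g) 0 T where
  continuousOn := hg.continuousOn
  hasDerivAt s hs := by
    have h1 : DifferentiableWithinAt ℝ g (Icc 0 T) s :=
      hg.differentiableOn one_ne_zero s (Ioo_subset_Icc_self hs)
    exact h1.hasDerivWithinAt.hasDerivAt (Icc_mem_nhds hs.1 hs.2)
  continuousOn_deriv := hg.continuousOn_derivWithin (uniqueDiffOn_Icc hT) le_rfl

namespace RegularMarket

variable {K ρ : ℝ → ℝ} {T t : ℝ}

theorem hasContDerivOn_K (H : RegularMarket K ρ T) : HasContDerivOn K (dI T K) 0 T :=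
  hasContDerivOn_dI H.pos (H.contDiffOn_K.of_le one_le_two)

theorem hasContDerivOn_f (H : RegularMarket K ρ T) :
    HasContDerivOn (fFn K ρ T) (dI T (fFn K ρ T)) 0 T := by
  refine hasContDerivOn_dI H.pos ?_
  have hK1 : ContDiffOn ℝ 1 K (Icc 0 T) := H.contDiffOn_K.of_le one_le_two
  have hK' : ContDiffOn ℝ 1 (dI T K) (Icc 0 T) :=
    H.contDiffOn_K.derivWithin (uniqueDiffOn_Icc H.pos) (by norm_num)
  exact (hK'.add (H.contDiffOn_ρ.mul hK1)).div
    (hK'.add ((contDiffOn_const.mul H.contDiffOn_ρ).mul hK1)) fun s hs => (H.denom_pos s hs).ne'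

theorem continuousOn_rate (H : RegularMarket K ρ T) : ContinuousOn (rate K ρ T) (Icc 0 T) :=
  (H.hasContDerivOn_f.continuousOn_deriv.add
    (H.contDiffOn_ρ.continuousOn.mul H.hasContDerivOn_f.continuousOn)).div
    H.contDiffOn_K.continuousOn fun s hs => (H.K_pos s hs).ne'

theorem f_lt_one (H : RegularMarket K ρ T) (ht : t ∈ Icc 0 T) : fFn K ρ T t < 1 := by
  rw [fFn, div_lt_one (H.denom_pos t ht)]
  nlinarith [mul_pos (H.ρ_pos t ht) (H.K_pos t ht)]

theorem mem_Icc (ht : t ∈ Icc 0 T) {s : ℝ} (hs : s ∈ Icc t T) : s ∈ Icc 0 T :=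
  ⟨ht.1.trans hs.1, hs.2⟩

theorem continuousOn_ρ (H : RegularMarket K ρ T) (ht : t ∈ Icc 0 T) :
    ContinuousOn ρ (Icc t T) :=
  H.contDiffOn_ρ.continuousOn.mono (Icc_subset_Icc ht.1 le_rfl)

theorem hasContDerivOn_resilience (H : RegularMarket K ρ T) (ht : t ∈ Icc 0 T) :
    HasContDerivOn (fun s => ∫ u in t..s, ρ u) ρ t T :=
  HasContDerivOn.primitive (H.continuousOn_ρ ht) ht.2

theorem integral_ρ_eq_sub (H : RegularMarket K ρ T) (ht : t ∈ Icc 0 T) {u s : ℝ}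
    (hu : u ∈ Icc t T) (hs : s ∈ Icc t T) :
    ∫ r in u..s, ρ r = (∫ r in t..s, ρ r) - ∫ r in t..u, ρ r := by
  have hi : ∀ v ∈ Icc t T, IntervalIntegrable ρ volume t v := fun v hv =>
    ((H.continuousOn_ρ ht).mono (Icc_subset_Icc le_rfl hv.2)).intervalIntegrable_of_Icc hv.1
  rw [intervalIntegral.integral_interval_sub_left (hi s hs) (hi u hu)]

theorem hasContDerivOn_impact (H : RegularMarket K ρ T) (ht : t ∈ Icc 0 T) :
    HasContDerivOn (impact K ρ t)
      (fun s => (dI T K s + ρ s * K s) * Real.exp (∫ u in t..s, ρ u)) t T :=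
  ((H.hasContDerivOn_K.mono ht.1 le_rfl).mul (H.hasContDerivOn_resilience ht).exp).congr_deriv
    fun s _ => by ring

theorem impact_pos (H : RegularMarket K ρ T) (ht : t ∈ Icc 0 T) {s : ℝ} (hs : s ∈ Icc t T) :
    0 < impact K ρ t s :=
  mul_pos (H.K_pos s (mem_Icc ht hs)) (Real.exp_pos _)

theorem costWeight_pos (H : RegularMarket K ρ T) (ht : t ∈ Icc 0 T) {s : ℝ} (hs : s ∈ Icc t T) :
    0 < costWeight K ρ T t s :=
  mul_pos (div_pos (H.denom_pos s (mem_Icc ht hs)) (pow_pos (H.K_pos s (mem_Icc ht hs)) 2))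
    (Real.exp_pos _)

theorem hasContDerivOn_inv_K (H : RegularMarket K ρ T) (ht : t ∈ Icc 0 T) :
    HasContDerivOn (fun s => (K s)⁻¹) (fun s => -dI T K s / K s ^ 2) t T :=
  (H.hasContDerivOn_K.mono ht.1 le_rfl).inv fun s hs => (H.K_pos s (mem_Icc ht hs)).ne'

theorem hasContDerivOn_inv_K_mul_exp_sq (H : RegularMarket K ρ T) (ht : t ∈ Icc 0 T) :
    HasContDerivOn (fun s => (K s)⁻¹ * Real.exp (-(2 * ∫ u in t..s, ρ u)))
      (fun s => -costWeight K ρ T t s) t T := by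
  have h2 : HasContDerivOn (fun s => -(2 * ∫ u in t..s, ρ u)) (fun s => -(2 * ρ s)) t T := by
    have h := H.hasContDerivOn_resilience ht
    exact ⟨(h.continuousOn.const_mul 2).neg, fun s hs => ((h.hasDerivAt s hs).const_mul 2).neg,
      (h.continuousOn_deriv.const_mul 2).neg⟩
  refine ((H.hasContDerivOn_inv_K ht).mul h2.exp).congr_deriv fun s hs => ?_
  have := (H.K_pos s (mem_Icc ht hs)).ne'
  rw [costWeight]
  field_simp
  ring

theorem costWeight_mul_profile (H : RegularMarket K ρ T) (ht : t ∈ Icc 0 T) {s : ℝ}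
    (hs : s ∈ Icc t T) : costWeight K ρ T t s * profile K ρ T t s =
      (dI T K s + ρ s * K s) / K s ^ 2 * Real.exp (-∫ u in t..s, ρ u) := by
  have h1 := (H.K_pos s (mem_Icc ht hs)).ne'
  have h2 := (H.denom_pos s (mem_Icc ht hs)).ne'
  have h3 : Real.exp (-(2 * ∫ u in t..s, ρ u)) * Real.exp (∫ u in t..s, ρ u) =
      Real.exp (-∫ u in t..s, ρ u) := by rw [← Real.exp_add]; ring_nf
  rw [← h3, costWeight, profile, fFn]
  field_simp

theorem costWeight_mul_profile_sq (H : RegularMarket K ρ T) (ht : t ∈ Icc 0 T) {s : ℝ}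
    (hs : s ∈ Icc t T) : costWeight K ρ T t s * profile K ρ T t s ^ 2 =
      (dI T K s + 2 * ρ s * K s) * (fFn K ρ T s ^ 2 / K s ^ 2) := by
  have h1 := (H.K_pos s (mem_Icc ht hs)).ne'
  have h3 : Real.exp (-(2 * ∫ u in t..s, ρ u)) * Real.exp (∫ u in t..s, ρ u) ^ 2 = 1 := by
    rw [sq, ← Real.exp_add, ← Real.exp_add, ← Real.exp_zero]; ring_nf
  rw [costWeight, profile]
  calc _ = (dI T K s + 2 * ρ s * K s) * (fFn K ρ T s ^ 2 / K s ^ 2) *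
        (Real.exp (-(2 * ∫ u in t..s, ρ u)) * Real.exp (∫ u in t..s, ρ u) ^ 2) := by ring
    _ = _ := by rw [h3, mul_one]

theorem hasContDerivOn_inv_K_mul_exp (H : RegularMarket K ρ T) (ht : t ∈ Icc 0 T) :
    HasContDerivOn (fun s => (K s)⁻¹ * Real.exp (-∫ u in t..s, ρ u))
      (fun s => -(costWeight K ρ T t s * profile K ρ T t s)) t T := by
  refine ((H.hasContDerivOn_inv_K ht).mul
    (H.hasContDerivOn_resilience ht).neg.exp).congr_deriv fun s hs => ?_
  have := (H.K_pos s (mem_Icc ht hs)).ne'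
  rw [H.costWeight_mul_profile ht hs]
  field_simp
  ring

theorem hasContDerivOn_profile (H : RegularMarket K ρ T) (ht : t ∈ Icc 0 T) :
    HasContDerivOn (profile K ρ T t) (fun s => impact K ρ t s * rate K ρ T s) t T := by
  refine ((H.hasContDerivOn_resilience ht).exp.mul
    (H.hasContDerivOn_f.mono ht.1 le_rfl)).congr_deriv fun s hs => ?_
  have := (H.K_pos s (mem_Icc ht hs)).ne'
  rw [impact, rate]
  field_simp
  ring

theorem continuousOn_costWeight (H : RegularMarket K ρ T) (ht : t ∈ Icc 0 T) :
    ContinuousOn (costWeight K ρ T t) (Icc t T) :=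
  (H.hasContDerivOn_inv_K_mul_exp_sq ht).continuousOn_deriv.neg.congr fun _ _ =>
    (neg_neg _).symm

/-- The closed form of the squared norm of the optimal shape; it comes from integrating the
derivative of `f / K`. -/
theorem totalConst_eq (H : RegularMarket K ρ T) (ht : t ∈ Icc 0 T) :
    totalConst K ρ T t =
      (∫ s in t..T, costWeight K ρ T t s * profile K ρ T t s ^ 2) + 1 / K T := by
  have hr : IntervalIntegrable (rate K ρ T) volume t T :=
    (H.continuousOn_rate.mono (Icc_subset_Icc ht.1 le_rfl)).intervalIntegrable_of_Icc ht.2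
  have hw : IntervalIntegrable (fun s => costWeight K ρ T t s * profile K ρ T t s ^ 2) volume t T :=
    ((H.continuousOn_costWeight ht).mul
      ((H.hasContDerivOn_profile ht).continuousOn.pow 2)).intervalIntegrable_of_Icc ht.2
  have hFTC := (((H.hasContDerivOn_f.mono ht.1 le_rfl).mul
    (H.hasContDerivOn_inv_K ht)).congr_deriv (χ' := fun s => rate K ρ T s -
      costWeight K ρ T t s * profile K ρ T t s ^ 2) fun s hs => by
        have h1 := (H.K_pos s (mem_Icc ht hs)).ne'
        have h2 := (H.denom_pos s (mem_Icc ht hs)).ne'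
        have h3 : (dI T K s + 2 * ρ s * K s) * fFn K ρ T s = dI T K s + ρ s * K s := by
          rw [fFn, mul_div_cancel₀ _ h2]
        have h4 : (dI T K s + 2 * ρ s * K s) * (fFn K ρ T s ^ 2 / K s ^ 2) =
            (dI T K s + ρ s * K s) * fFn K ρ T s / K s ^ 2 := by rw [← h3]; ring
        rw [H.costWeight_mul_profile_sq ht hs, rate, h4]
        field_simp
        ring).integral_eq ht.2
  rw [intervalIntegral.integral_sub hr hw] at hFTC
  rw [totalConst, barrierNum]
  linear_combination hFTC

theorem integral_impact_mul_rate (H : RegularMarket K ρ T) (ht : t ∈ Icc 0 T) {s : ℝ}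
    (hs : s ∈ Icc t T) :
    ∫ r in t..s, impact K ρ t r * rate K ρ T r = profile K ρ T t s - fFn K ρ T t := by
  rw [((H.hasContDerivOn_profile ht).mono le_rfl hs.2).integral_eq hs.1]
  simp [profile]

theorem totalConst_pos (H : RegularMarket K ρ T) (ht : t ∈ Icc 0 T) :
    0 < totalConst K ρ T t := by
  rw [H.totalConst_eq ht]
  refine add_pos_of_nonneg_of_pos (intervalIntegral.integral_nonneg ht.2 fun s hs =>
    mul_nonneg (H.costWeight_pos ht hs).le (sq_nonneg _)) ?_
  exact one_div_pos.2 (H.K_pos T ⟨H.pos.le, le_rfl⟩)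

end RegularMarket

/-! ### The cost in terms of the deviation -/

namespace Strategy

variable {t T : ℝ}

theorem integral_quadratic (Θ : Strategy t T) {h : ℝ → ℝ} (hh : Integrable h Θ.measure) :
    ∫ s, h s * (∫ u in Iio s, h u ∂Θ.measure + h s * Θ.jump s / 2) ∂Θ.measure =
      (∫ s, h s ∂Θ.measure) ^ 2 / 2 := by
  simp only [← measureReal_singleton]
  exact (integral_mul_integral_Iio_add_half_atom hh).2

theorem integrable_quadratic (Θ : Strategy t T) {h : ℝ → ℝ} (hh : Integrable h Θ.measure) :
    Integrable (fun s => h s * (∫ u in Iio s, h u ∂Θ.measure + h s * Θ.jump s / 2)) Θ.measure := by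
  simp only [← measureReal_singleton]
  exact (integral_mul_integral_Iio_add_half_atom hh).1

theorem setIntegral_quadratic (Θ : Strategy t T) {h : ℝ → ℝ} (hh : Integrable h Θ.measure)
    (r : ℝ) :
    ∫ s in Iio r, h s * (∫ u in Iio s, h u ∂Θ.measure + h s * Θ.jump s / 2) ∂Θ.measure =
      (∫ s in Iio r, h s ∂Θ.measure) ^ 2 / 2 := by
  rw [← (integral_mul_integral_Iio_add_half_atom (hh.restrict (s := Iio r))).2]
  refine setIntegral_congr_fun measurableSet_Iio fun s hs => ?_
  have hs : s < r := hs
  rw [Measure.restrict_restrict measurableSet_Iio, Iio_inter_Iio, min_eq_left hs.le,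
    ← measureReal_singleton, measureReal_restrict_apply (measurableSet_singleton s),
    inter_eq_left.2 (singleton_subset_iff.2 (mem_Iio.2 hs))]

end Strategy

namespace RegularMarket

variable {K ρ : ℝ → ℝ} {T t : ℝ}

theorem integrable_impact (H : RegularMarket K ρ T) (ht : t ∈ Icc 0 T) (Θ : Strategy t T) :
    Integrable (impact K ρ t) Θ.measure :=
  Θ.integrable_of_continuousOn (H.hasContDerivOn_impact ht).continuousOn

theorem ae_impact_nonneg (H : RegularMarket K ρ T) (ht : t ∈ Icc 0 T) (Θ : Strategy t T) :
    0 ≤ᵐ[Θ.measure] impact K ρ t := by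
  filter_upwards [Θ.ae_mem_Icc] with s hs using (H.impact_pos ht hs).le

theorem monotone_compDev (H : RegularMarket K ρ T) (ht : t ∈ Icc 0 T) (Θ : Strategy t T) (δ : ℝ) :
    Monotone (compDev K ρ δ Θ) := fun _ _ huv =>
  add_le_add le_rfl (setIntegral_mono_set (H.integrable_impact ht Θ).integrableOn
    (ae_restrict_of_ae (H.ae_impact_nonneg ht Θ)) (Iio_subset_Iio huv).eventuallyLE)

theorem le_compDev (H : RegularMarket K ρ T) (ht : t ∈ Icc 0 T) (Θ : Strategy t T) (δ s : ℝ) :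
    δ ≤ compDev K ρ δ Θ s :=
  le_add_of_nonneg_right (integral_nonneg_of_ae (ae_restrict_of_ae (H.ae_impact_nonneg ht Θ)))

theorem intervalIntegrable_mul_compDev (H : RegularMarket K ρ T) (ht : t ∈ Icc 0 T)
    (Θ : Strategy t T) (δ : ℝ) {g : ℝ → ℝ} (hg : ContinuousOn g (Icc t T)) :
    IntervalIntegrable (fun s => g s * compDev K ρ δ Θ s) volume t T :=
  (H.monotone_compDev ht Θ δ).intervalIntegrable.continuousOn_mul (by rwa [uIcc_of_le ht.2])

theorem intervalIntegrable_mul_compDev_sq (H : RegularMarket K ρ T) (ht : t ∈ Icc 0 T)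
    (Θ : Strategy t T) {δ : ℝ} (hδ : 0 ≤ δ) {g : ℝ → ℝ} (hg : ContinuousOn g (Icc t T)) :
    IntervalIntegrable (fun s => g s * compDev K ρ δ Θ s ^ 2) volume t T := by
  have : Monotone fun s => compDev K ρ δ Θ s ^ 2 := fun u v huv =>
    pow_le_pow_left₀ (hδ.trans (H.le_compDev ht Θ δ u)) (H.monotone_compDev ht Θ δ huv) 2
  exact this.intervalIntegrable.continuousOn_mul (by rwa [uIcc_of_le ht.2])

theorem deviation_eq (H : RegularMarket K ρ T) (ht : t ∈ Icc 0 T) (Θ : Strategy t T) (δ : ℝ)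
    {s : ℝ} (hs : s ∈ Icc t T) :
    deviation K ρ δ Θ s = Real.exp (-∫ u in t..s, ρ u) * compDev K ρ δ Θ s := by
  rw [deviation, compDev, ← Θ.setIntegral_Ico, mul_add, ← integral_const_mul, mul_comm δ]
  congr 1
  refine setIntegral_congr_fun measurableSet_Ico fun u hu => ?_
  have hu' : u ∈ Icc t T := ⟨hu.1, hu.2.le.trans hs.2⟩
  simp only [impact]
  rw [H.integral_ρ_eq_sub ht hu' hs, neg_sub, sub_eq_add_neg, Real.exp_add]
  ring

/-- The cost as a quadratic functional of the deviation alone: formally, integrate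
`(D + K ΔΘ / 2) dΘ = exp(-2∫ρ) / K * d(E²) / 2` by parts, where `E` is the compounded deviation. -/
theorem cost_eq (H : RegularMarket K ρ T) (ht : t ∈ Icc 0 T) (Θ : Strategy t T) {δ : ℝ}
    (hδ : 0 ≤ δ) :
    cost K ρ δ Θ = ((∫ r in t..T, costWeight K ρ T t r * compDev K ρ δ Θ r ^ 2) +
      Real.exp (-(2 * ∫ u in t..T, ρ u)) / K T * compDevFinal K ρ δ Θ ^ 2) / 2 -
        δ ^ 2 / (2 * K t) := by
  have hi := H.integrable_impact ht Θ
  have hφ := H.hasContDerivOn_inv_K_mul_exp_sq ht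
  set F : ℝ → ℝ := fun s => δ * impact K ρ t s + impact K ρ t s *
    (∫ u in Iio s, impact K ρ t u ∂Θ.measure + impact K ρ t s * Θ.jump s / 2) with hFdef
  have hF : Integrable F Θ.measure := (hi.const_mul δ).add (Θ.integrable_quadratic hi)
  have h1 : cost K ρ δ Θ =
      ∫ s, (K s)⁻¹ * Real.exp (-(2 * ∫ u in t..s, ρ u)) * F s ∂Θ.measure := by
    rw [cost, Θ.restrict_Icc]
    refine integral_congr_ae ?_
    filter_upwards [Θ.ae_mem_Icc] with s hs
    have hK := (H.K_pos s (mem_Icc ht hs)).ne'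
    have he : Real.exp (-(2 * ∫ u in t..s, ρ u)) =
        Real.exp (-∫ u in t..s, ρ u) * Real.exp (-∫ u in t..s, ρ u) := by
      rw [← Real.exp_add]; ring_nf
    have he' : Real.exp (-∫ u in t..s, ρ u) * Real.exp (∫ u in t..s, ρ u) = 1 := by
      rw [← Real.exp_add]; simp
    rw [H.deviation_eq ht Θ δ hs, he, hFdef, compDev]
    simp only [impact]
    generalize (∫ u in Iio s, K u * Real.exp (∫ u in t..u, ρ u) ∂Θ.measure) = N
    generalize Real.exp (-∫ u in t..s, ρ u) = e at he' ⊢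
    generalize Real.exp (∫ u in t..s, ρ u) = e' at he' ⊢
    field_simp
    linear_combination (- 2 * (δ + N) * e - K s * Θ.jump s * (1 + e * e')) * he'
  have h2 : ∫ s, F s ∂Θ.measure = (compDevFinal K ρ δ Θ ^ 2 - δ ^ 2) / 2 := by
    rw [hFdef, integral_add (hi.const_mul δ) (Θ.integrable_quadratic hi), integral_const_mul,
      Θ.integral_quadratic hi, compDevFinal]
    ring
  have h3 : ∀ r, ∫ s in Iio r, F s ∂Θ.measure = (compDev K ρ δ Θ r ^ 2 - δ ^ 2) / 2 := fun r => by
    rw [hFdef, integral_add (hi.const_mul δ).restrict (Θ.integrable_quadratic hi).restrict,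
      integral_const_mul, Θ.setIntegral_quadratic hi, compDev]
    ring
  have hw := H.continuousOn_costWeight ht
  have i1 : IntervalIntegrable (fun r => -(costWeight K ρ T t r * compDev K ρ δ Θ r ^ 2) / 2)
      volume t T := (H.intervalIntegrable_mul_compDev_sq ht Θ hδ hw).neg.div_const 2
  have h4 : ∫ r in t..T, -costWeight K ρ T t r * ∫ s in Iio r, F s ∂Θ.measure =
      -(∫ r in t..T, costWeight K ρ T t r * compDev K ρ δ Θ r ^ 2) / 2 -
        δ ^ 2 / 2 * ∫ r in t..T, -costWeight K ρ T t r := by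
    rw [← intervalIntegral.integral_const_mul, ← intervalIntegral.integral_neg,
      ← intervalIntegral.integral_div, ← intervalIntegral.integral_sub i1
      ((hφ.intervalIntegrable ht.2).const_mul _)]
    refine intervalIntegral.integral_congr fun r _ => ?_
    simp only [h3]
    ring
  have hKt := (H.K_pos t ht).ne'
  rw [h1, Θ.integral_mul_eq ht.2 hφ hF, h2, h4, hφ.integral_eq ht.2]
  simp only [intervalIntegral.integral_same, mul_zero, neg_zero, Real.exp_zero]
  field_simp
  ring

/-- The budget constraint as a linear functional of the deviation. -/
theorem final_add_eq (H : RegularMarket K ρ T) (ht : t ∈ Icc 0 T) (Θ : Strategy t T) (δ : ℝ) :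
    Θ.final + δ / K t =
      (∫ r in t..T, costWeight K ρ T t r * profile K ρ T t r * compDev K ρ δ Θ r) +
        Real.exp (-∫ u in t..T, ρ u) / K T * compDevFinal K ρ δ Θ := by
  have hi := H.integrable_impact ht Θ
  have hψ := H.hasContDerivOn_inv_K_mul_exp ht
  have h1 : Θ.final =
      ∫ s, (K s)⁻¹ * Real.exp (-∫ u in t..s, ρ u) * impact K ρ t s ∂Θ.measure := by
    rw [← Θ.measureReal_univ, ← setIntegral_one_eq_measureReal, setIntegral_univ]
    refine integral_congr_ae ?_
    filter_upwards [Θ.ae_mem_Icc] with s hs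
    have hK := (H.K_pos s (mem_Icc ht hs)).ne'
    have he' : Real.exp (-∫ u in t..s, ρ u) * Real.exp (∫ u in t..s, ρ u) = 1 := by
      rw [← Real.exp_add]; simp
    rw [impact]
    field_simp
    rw [he']
  have i1 : IntervalIntegrable
      (fun r => -(costWeight K ρ T t r * profile K ρ T t r * compDev K ρ δ Θ r)) volume t T :=
    (H.intervalIntegrable_mul_compDev ht Θ δ
      ((H.continuousOn_costWeight ht).mul (H.hasContDerivOn_profile ht).continuousOn)).neg
  have h4 : ∫ r in t..T, -(costWeight K ρ T t r * profile K ρ T t r) *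
        ∫ s in Iio r, impact K ρ t s ∂Θ.measure =
      -(∫ r in t..T, costWeight K ρ T t r * profile K ρ T t r * compDev K ρ δ Θ r) -
        δ * ∫ r in t..T, -(costWeight K ρ T t r * profile K ρ T t r) := by
    rw [← intervalIntegral.integral_const_mul, ← intervalIntegral.integral_neg,
      ← intervalIntegral.integral_sub i1
      ((hψ.intervalIntegrable ht.2).const_mul _)]
    refine intervalIntegral.integral_congr fun r _ => ?_
    simp only [compDev]
    ring
  rw [h1, Θ.integral_mul_eq ht.2 hψ hi, h4, hψ.integral_eq ht.2, compDevFinal]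
  simp only [intervalIntegral.integral_same, neg_zero, Real.exp_zero]
  field_simp
  ring

/-- A strategy is recovered from its compounded deviation. -/
theorem apply_eq (H : RegularMarket K ρ T) (ht : t ∈ Icc 0 T) (Θ : Strategy t T) {s : ℝ}
    (hs : s ∈ Icc t T) :
    Θ s = (K s)⁻¹ * Real.exp (-∫ u in t..s, ρ u) * compDev K ρ 0 Θ s +
      ∫ r in t..s, costWeight K ρ T t r * profile K ρ T t r * compDev K ρ 0 Θ r := by
  have hψ := H.hasContDerivOn_inv_K_mul_exp ht
  have h1 : Θ s =
      ∫ s in Iio s, (K s)⁻¹ * Real.exp (-∫ u in t..s, ρ u) * impact K ρ t s ∂Θ.measure := by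
    rw [← Θ.measureReal_Iio, ← setIntegral_one_eq_measureReal]
    refine integral_congr_ae ?_
    filter_upwards [ae_restrict_of_ae Θ.ae_mem_Icc] with s hs
    have hK := (H.K_pos s (mem_Icc ht hs)).ne'
    have he' : Real.exp (-∫ u in t..s, ρ u) * Real.exp (∫ u in t..s, ρ u) = 1 := by
      rw [← Real.exp_add]; simp
    rw [impact]
    field_simp
    rw [he']
  rw [h1, Θ.setIntegral_Iio_mul_eq hψ (H.integrable_impact ht Θ) hs]
  simp only [compDev, zero_add, neg_mul, intervalIntegral.integral_neg, sub_neg_eq_add]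

/-- Completing the square in the cost under the budget constraint. -/
theorem cost_eq_add_excess (H : RegularMarket K ρ T) (ht : t ∈ Icc 0 T) (Θ : Strategy t T)
    {δ d : ℝ} (hδ : 0 ≤ δ) (hd : Θ.final + δ / K t = d * totalConst K ρ T t) :
    cost K ρ δ Θ =
      d ^ 2 * totalConst K ρ T t / 2 - δ ^ 2 / (2 * K t) + excess K ρ δ Θ d / 2 := by
  have hw := H.continuousOn_costWeight ht
  have hp := (H.hasContDerivOn_profile ht).continuousOn
  have i1 := H.intervalIntegrable_mul_compDev_sq ht Θ hδ hw
  have i2 : IntervalIntegrable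
      (fun r => costWeight K ρ T t r * profile K ρ T t r * compDev K ρ δ Θ r) volume t T :=
    H.intervalIntegrable_mul_compDev ht Θ δ (hw.mul hp)
  have i3 : IntervalIntegrable (fun r => costWeight K ρ T t r * profile K ρ T t r ^ 2) volume t T :=
    (hw.mul (hp.pow 2)).intervalIntegrable_of_Icc ht.2
  have h1 : ∫ r in t..T, costWeight K ρ T t r * (compDev K ρ δ Θ r - d * profile K ρ T t r) ^ 2 =
      (∫ r in t..T, costWeight K ρ T t r * compDev K ρ δ Θ r ^ 2) -
      2 * d * (∫ r in t..T, costWeight K ρ T t r * profile K ρ T t r * compDev K ρ δ Θ r) +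
      d ^ 2 * ∫ r in t..T, costWeight K ρ T t r * profile K ρ T t r ^ 2 := by
    rw [← intervalIntegral.integral_const_mul, ← intervalIntegral.integral_const_mul,
      ← intervalIntegral.integral_sub i1 (i2.const_mul _),
      ← intervalIntegral.integral_add (i1.sub (i2.const_mul _)) (i3.const_mul _)]
    refine intervalIntegral.integral_congr fun r _ => ?_
    ring
  have hc := H.final_add_eq ht Θ δ
  rw [hd] at hc
  have he : Real.exp (-(2 * ∫ u in t..T, ρ u)) * Real.exp (∫ u in t..T, ρ u) =
      Real.exp (-∫ u in t..T, ρ u) := by rw [← Real.exp_add]; ring_nf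
  have he' : Real.exp (-∫ u in t..T, ρ u) * Real.exp (∫ u in t..T, ρ u) = 1 := by
    rw [← Real.exp_add]; simp
  have htot := H.totalConst_eq ht
  have hKT : K T ≠ 0 := (H.K_pos T ⟨H.pos.le, le_rfl⟩).ne'
  rw [H.cost_eq ht Θ hδ, excess, h1]
  rw [← he] at hc
  have he2 : Real.exp (-(2 * ∫ u in t..T, ρ u)) * Real.exp (∫ u in t..T, ρ u) ^ 2 = 1 := by
    rw [sq, ← mul_assoc, he, he']
  generalize (∫ r in t..T, costWeight K ρ T t r * profile K ρ T t r * compDev K ρ δ Θ r) = B at hc ⊢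
  generalize (∫ r in t..T, costWeight K ρ T t r * profile K ρ T t r ^ 2) = C at htot ⊢
  generalize Real.exp (-(2 * ∫ u in t..T, ρ u)) = e at hc he2 ⊢
  generalize Real.exp (∫ u in t..T, ρ u) = e' at hc he2 ⊢
  linear_combination -d * hc + d ^ 2 / 2 * htot - d ^ 2 / (2 * K T) * he2

end RegularMarket

/-! ### The excess cost of a strategy -/

/-- A regular market in which `f_0 ≥ 0` and `f' + ρ f ≥ 0`. -/
structure BuyingMarket (K ρ : ℝ → ℝ) (T : ℝ) : Prop extends RegularMarket K ρ T where
  f_zero_nonneg : 0 ≤ fFn K ρ T 0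
  deriv_add_nonneg : ∀ t ∈ Icc 0 T, 0 ≤ dI T (fFn K ρ T) t + ρ t * fFn K ρ T t

/-- `(x + δ / K_t) / c̄_t`: the constant multiple of the optimal shape that satisfies the budget
constraint. -/
noncomputable def optScale (K ρ : ℝ → ℝ) (T t δ x : ℝ) : ℝ :=
  (x + δ / K t) / totalConst K ρ T t

theorem Strategy.exists_final_eq {t T : ℝ} (htT : t ≤ T) {x : ℝ} (hx : 0 ≤ x) :
    ∃ Θ : Strategy t T, Θ.final = x := by
  refine ⟨(0 : Strategy t T).combine htT (g := 0) continuousOn_const (fun _ _ => le_rfl)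
    le_rfl hx le_rfl le_rfl, ?_⟩
  rw [Strategy.combine_final]
  simp

namespace RegularMarket

variable {K ρ : ℝ → ℝ} {T t : ℝ}

theorem excess_nonneg (H : RegularMarket K ρ T) (ht : t ∈ Icc 0 T) (Θ : Strategy t T)
    (δ d : ℝ) : 0 ≤ excess K ρ δ Θ d := by
  refine add_nonneg (intervalIntegral.integral_nonneg ht.2 fun s hs =>
    mul_nonneg (H.costWeight_pos ht hs).le (sq_nonneg _)) ?_
  have := H.K_pos T ⟨H.pos.le, le_rfl⟩
  positivity

theorem integral_le_excess (H : RegularMarket K ρ T) (Θ : Strategy t T) (δ d : ℝ) :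
    ∫ r in t..T, costWeight K ρ T t r * (compDev K ρ δ Θ r - d * profile K ρ T t r) ^ 2 ≤
      excess K ρ δ Θ d := by
  have := H.K_pos T ⟨H.pos.le, le_rfl⟩
  exact le_add_of_nonneg_right (by positivity)

theorem intervalIntegrable_excess (H : RegularMarket K ρ T) (ht : t ∈ Icc 0 T) (Θ : Strategy t T)
    {δ : ℝ} (hδ : 0 ≤ δ) (d : ℝ) :
    IntervalIntegrable (fun r => costWeight K ρ T t r *
      (compDev K ρ δ Θ r - d * profile K ρ T t r) ^ 2) volume t T := by
  have hw := H.continuousOn_costWeight ht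
  have hp := (H.hasContDerivOn_profile ht).continuousOn
  have i1 := H.intervalIntegrable_mul_compDev_sq ht Θ hδ hw
  have i2 : IntervalIntegrable
      (fun r => costWeight K ρ T t r * profile K ρ T t r * compDev K ρ δ Θ r) volume t T :=
    H.intervalIntegrable_mul_compDev ht Θ δ (hw.mul hp)
  have i3 : IntervalIntegrable (fun r => costWeight K ρ T t r * profile K ρ T t r ^ 2) volume t T :=
    (hw.mul (hp.pow 2)).intervalIntegrable_of_Icc ht.2
  refine ((i1.sub (i2.const_mul (2 * d))).add (i3.const_mul (d ^ 2))).congr fun r _ => ?_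
  ring

/-- Vanishing excess determines the compounded deviation almost everywhere, hence the strategy. -/
theorem excess_eq_zero_unique (H : RegularMarket K ρ T) (ht : t ∈ Icc 0 T) {Θ Θ' : Strategy t T}
    {δ d : ℝ} (hδ : 0 ≤ δ) (hf : Θ.final = Θ'.final) (h : excess K ρ δ Θ d = 0)
    (h' : excess K ρ δ Θ' d = 0) : Θ = Θ' := by
  have key : ∀ Φ : Strategy t T, excess K ρ δ Φ d = 0 →
      ∀ᵐ r, r ∈ Ioc t T → compDev K ρ δ Φ r = d * profile K ρ T t r := by
    intro Φ hΦ
    have h0 : ∫ r in t..T, costWeight K ρ T t r *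
        (compDev K ρ δ Φ r - d * profile K ρ T t r) ^ 2 = 0 :=
      le_antisymm (hΦ ▸ H.integral_le_excess Φ δ d) (intervalIntegral.integral_nonneg ht.2
        fun s hs => mul_nonneg (H.costWeight_pos ht hs).le (sq_nonneg _))
    rw [intervalIntegral.integral_eq_zero_iff_of_le_of_nonneg_ae ht.2 ?_
      (H.intervalIntegrable_excess ht Φ hδ d)] at h0
    · filter_upwards [(ae_restrict_iff' measurableSet_Ioc).1 h0] with r hr hrm
      have hw := (H.costWeight_pos ht (Ioc_subset_Icc_self hrm)).ne'
      have := hr hrm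
      simp only [Pi.zero_apply, mul_eq_zero, hw, false_or] at this
      exact sub_eq_zero.1 (pow_eq_zero_iff two_ne_zero |>.1 this)
    · filter_upwards [ae_restrict_mem measurableSet_Ioc] with s hs
      exact mul_nonneg (H.costWeight_pos ht (Ioc_subset_Icc_self hs)).le (sq_nonneg _)
  have hE : ∀ᵐ r, r ∈ Ioc t T → compDev K ρ 0 Θ r = compDev K ρ 0 Θ' r := by
    filter_upwards [key Θ h, key Θ' h'] with r h1 h2 hr
    have := (h1 hr).trans (h2 hr).symm
    simpa [compDev] using this
  refine Strategy.ext_of_ae_eq hf ?_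
  filter_upwards [hE] with s hs hsm
  rw [H.apply_eq ht Θ (Ioc_subset_Icc_self hsm), H.apply_eq ht Θ' (Ioc_subset_Icc_self hsm), hs hsm]
  congr 1
  refine intervalIntegral.integral_congr_ae ?_
  filter_upwards [hE] with r hr hrm
  rw [uIoc_of_le hsm.1.le] at hrm
  rw [hr ⟨hrm.1, hrm.2.trans hsm.2⟩]

theorem cost_eq_optScale (H : RegularMarket K ρ T) (ht : t ∈ Icc 0 T) (Θ : Strategy t T)
    {δ x : ℝ} (hδ : 0 ≤ δ) (hx : Θ.final = x) :
    cost K ρ δ Θ = optScale K ρ T t δ x ^ 2 * totalConst K ρ T t / 2 - δ ^ 2 / (2 * K t) +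
      excess K ρ δ Θ (optScale K ρ T t δ x) / 2 :=
  H.cost_eq_add_excess ht Θ hδ (by
    rw [optScale, hx, div_mul_cancel₀ _ (H.totalConst_pos ht).ne'])

theorem bddBelow_cost (H : RegularMarket K ρ T) (ht : t ∈ Icc 0 T) {δ : ℝ} (hδ : 0 ≤ δ) (x : ℝ) :
    BddBelow {j | ∃ Θ : Strategy t T, Θ.final = x ∧ cost K ρ δ Θ = j} := by
  refine ⟨optScale K ρ T t δ x ^ 2 * totalConst K ρ T t / 2 - δ ^ 2 / (2 * K t), ?_⟩
  rintro _ ⟨Θ, hΘ, rfl⟩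
  rw [H.cost_eq_optScale ht Θ hδ hΘ]
  linarith [H.excess_nonneg ht Θ δ (optScale K ρ T t δ x)]

/-- At the terminal time only one strategy is available. -/
theorem valueFn_terminal (H : RegularMarket K ρ T) {δ x : ℝ} (hδ : 0 ≤ δ) (hx : 0 ≤ x) :
    valueFn K ρ T T δ x = (δ + K T / 2 * x) * x := by
  have hT : T ∈ Icc 0 T := ⟨H.pos.le, le_rfl⟩
  have hK := (H.K_pos T hT).ne'
  have hset : {j | ∃ Θ : Strategy T T, Θ.final = x ∧ cost K ρ δ Θ = j} =
      {(δ + K T / 2 * x) * x} := by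
    have hcost : ∀ Θ : Strategy T T, Θ.final = x → cost K ρ δ Θ = (δ + K T / 2 * x) * x := by
      intro Θ hΘ
      have h1 := H.final_add_eq hT Θ δ
      rw [H.cost_eq hT Θ hδ]
      simp only [intervalIntegral.integral_same, mul_zero, neg_zero, Real.exp_zero, zero_add,
        hΘ] at h1 ⊢
      have h2 : compDevFinal K ρ δ Θ = K T * x + δ := by
        field_simp at h1
        linarith
      rw [h2]
      field_simp
      ring
    ext j
    constructor
    · rintro ⟨Θ, hΘ, rfl⟩; exact hcost Θ hΘ
    · rintro rfl
      obtain ⟨Θ, hΘ⟩ := Strategy.exists_final_eq le_rfl hx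
      exact ⟨Θ, hΘ, hcost Θ hΘ⟩
  rw [valueFn, hset, csInf_singleton]

/-- If the initial deviation exceeds the starting value `d f_t` of the optimal path, then no
strategy can approach this path, because the compounded deviation never decreases. -/
theorem exists_pos_le_excess (H : RegularMarket K ρ T) (ht : t ∈ Ico 0 T) {δ d : ℝ} (hδ : 0 ≤ δ)
    (hd : d * fFn K ρ T t < δ) : ∃ κ > 0, ∀ Θ : Strategy t T, κ ≤ excess K ρ δ Θ d := by
  have ht' : t ∈ Icc 0 T := Ico_subset_Icc_self ht
  set η := (δ - d * fFn K ρ T t) / 2 with hη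
  have hη0 : 0 < η := by rw [hη]; linarith
  have hw := H.continuousOn_costWeight ht'
  have hp := (H.hasContDerivOn_profile ht').continuousOn t (left_mem_Icc.2 ht.2.le)
  have hev : ∀ᶠ s in nhdsWithin t (Icc t T), d * profile K ρ T t s < δ - η := by
    refine (hp.const_mul d).eventually_lt_const ?_
    simp only [profile, intervalIntegral.integral_same, Real.exp_zero, one_mul]
    linarith
  rw [nhdsWithin_Icc_eq_nhdsGE ht.2, Filter.Eventually,
    mem_nhdsGE_iff_exists_Icc_subset] at hev
  obtain ⟨r, hr, hsub⟩ := hev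
  have hrT : min r T ≤ T := min_le_right _ _
  have htr : t < min r T := lt_min hr ht.2
  have i1 : IntervalIntegrable (fun s => costWeight K ρ T t s * η ^ 2) volume t (min r T) :=
    ((hw.mono (Icc_subset_Icc le_rfl hrT)).mul continuousOn_const).intervalIntegrable_of_Icc htr.le
  refine ⟨∫ s in t..min r T, costWeight K ρ T t s * η ^ 2,
    intervalIntegral.intervalIntegral_pos_of_pos_on i1 (fun s hs => mul_pos
      (H.costWeight_pos ht' ⟨hs.1.le, hs.2.le.trans hrT⟩) (pow_pos hη0 2)) htr, fun Θ => ?_⟩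
  have i2 := H.intervalIntegrable_excess ht' Θ hδ d
  refine le_trans ?_ (H.integral_le_excess Θ δ d)
  refine le_trans ?_ (intervalIntegral.integral_mono_interval (c := t) (a := t) (b := min r T)
    le_rfl htr.le hrT ?_ i2)
  · refine intervalIntegral.integral_mono_on htr.le i1
      (i2.mono_set (by rw [uIcc_of_le htr.le, uIcc_of_le ht.2.le]; exact Icc_subset_Icc le_rfl hrT))
      fun s hs => ?_
    have hs' : s ∈ Icc t T := ⟨hs.1, hs.2.trans hrT⟩
    refine mul_le_mul_of_nonneg_left ?_ (H.costWeight_pos ht' hs').le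
    have h1 : d * profile K ρ T t s < δ - η := hsub ⟨hs.1, hs.2.trans (min_le_left _ _)⟩
    have h2 := H.le_compDev ht' Θ δ s
    exact pow_le_pow_left₀ hη0.le (by linarith) 2
  · filter_upwards [ae_restrict_mem measurableSet_Ioc] with s hs
    exact mul_nonneg (H.costWeight_pos ht' (Ioc_subset_Icc_self hs)).le (sq_nonneg _)

end RegularMarket

/-! ### The optimal strategy above the barrier -/

namespace BuyingMarket

variable {K ρ : ℝ → ℝ} {T t : ℝ}

theorem rate_nonneg (H : BuyingMarket K ρ T) (ht : t ∈ Icc 0 T) : 0 ≤ rate K ρ T t :=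
  div_nonneg (H.deriv_add_nonneg t ht) (H.K_pos t ht).le

/-- The function `exp(∫_0^t ρ) f_t` is nondecreasing and starts at `f_0 ≥ 0`. -/
theorem f_nonneg (H : BuyingMarket K ρ T) (ht : t ∈ Icc 0 T) : 0 ≤ fFn K ρ T t := by
  have h0 : (0 : ℝ) ∈ Icc 0 T := ⟨le_rfl, H.pos.le⟩
  have h1 := H.integral_impact_mul_rate h0 ht
  have h2 : 0 ≤ ∫ r in (0 : ℝ)..t, impact K ρ 0 r * rate K ρ T r :=
    intervalIntegral.integral_nonneg ht.1 fun s hs =>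
      mul_nonneg (H.impact_pos h0 ⟨hs.1, hs.2.trans ht.2⟩).le
        (H.rate_nonneg ⟨hs.1, hs.2.trans ht.2⟩)
  have h3 : 0 ≤ profile K ρ T 0 t := by linarith [H.f_zero_nonneg]
  exact nonneg_of_mul_nonneg_right h3 (Real.exp_pos _)

theorem terminal_pos (H : BuyingMarket K ρ T) : 0 < (1 - fFn K ρ T T) / K T :=
  have hT : T ∈ Icc 0 T := ⟨H.pos.le, le_rfl⟩
  div_pos (sub_pos.2 (H.f_lt_one hT)) (H.K_pos T hT)

theorem barrierNum_pos (H : BuyingMarket K ρ T) (ht : t ∈ Icc 0 T) : 0 < barrierNum K ρ T t :=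
  add_pos_of_nonneg_of_pos (intervalIntegral.integral_nonneg ht.2 fun _ hs =>
    H.rate_nonneg (RegularMarket.mem_Icc ht hs)) H.terminal_pos

/-- The strategy that trades `w` times as much as `Θ`, buys `b` additional shares at the initial
time and, after that, `q` times as much as the unit optimal strategy. -/
noncomputable def blend (H : BuyingMarket K ρ T) (ht : t ∈ Icc 0 T) (Θ : Strategy t T)
    {w b q : ℝ} (hw : 0 ≤ w) (hb : 0 ≤ b) (hq : 0 ≤ q) : Strategy t T :=
  Θ.combine ht.2 (g := rate K ρ T) (p := q * ((1 - fFn K ρ T T) / K T))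
    (H.continuousOn_rate.mono (Icc_subset_Icc ht.1 le_rfl))
    (fun _ hs => H.rate_nonneg (RegularMarket.mem_Icc ht hs)) hw hb hq
    (mul_nonneg hq H.terminal_pos.le)

theorem blend_final (H : BuyingMarket K ρ T) (ht : t ∈ Icc 0 T) (Θ : Strategy t T)
    {w b q : ℝ} (hw : 0 ≤ w) (hb : 0 ≤ b) (hq : 0 ≤ q) :
    (H.blend ht Θ hw hb hq).final = w * Θ.final + b + q * barrierNum K ρ T t := by
  rw [blend, Strategy.combine_final, barrierNum]
  ring

/-- Moving from `Θ` a fraction `1 - w` of the way to the optimal path scales the excess cost by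
`w ^ 2`. -/
theorem excess_blend (H : BuyingMarket K ρ T) (ht : t ∈ Icc 0 T) (Θ : Strategy t T)
    {w b d δ δ' : ℝ} (hw : 0 ≤ w) (hb : 0 ≤ b) (hq : 0 ≤ (1 - w) * d)
    (hδ : δ' + b * K t - (1 - w) * d * fFn K ρ T t = w * δ) :
    excess K ρ δ' (H.blend ht Θ hw hb hq) d = w ^ 2 * excess K ρ δ Θ d := by
  have hT : T ∈ Icc t T := right_mem_Icc.2 ht.2
  have hK := (H.K_pos T (RegularMarket.mem_Icc ht hT)).ne'
  have himp := H.hasContDerivOn_impact ht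
  have h0 : impact K ρ t t = K t := by simp [impact]
  have h1 : ∀ s ∈ Ioc t T, compDev K ρ δ' (H.blend ht Θ hw hb hq) s - d * profile K ρ T t s =
      w * (compDev K ρ δ Θ s - d * profile K ρ T t s) := fun s hs => by
    rw [compDev, compDev, blend, Strategy.setIntegral_Iio_combine _ _ _ _ _ _ _ _ himp hs,
      H.integral_impact_mul_rate ht (Ioc_subset_Icc_self hs), h0]
    linear_combination hδ
  have h2 : compDevFinal K ρ δ' (H.blend ht Θ hw hb hq) - d * Real.exp (∫ u in t..T, ρ u) =
      w * (compDevFinal K ρ δ Θ - d * Real.exp (∫ u in t..T, ρ u)) := by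
    rw [compDevFinal, compDevFinal, blend, Strategy.integral_combine _ _ _ _ _ _ _ _ himp,
      H.integral_impact_mul_rate ht hT, h0]
    have : (1 - fFn K ρ T T) / K T * impact K ρ t T =
        Real.exp (∫ u in t..T, ρ u) - profile K ρ T t T := by
      rw [impact, profile]; field_simp
    linear_combination hδ + (1 - w) * d * this
  have h3 : ∫ r in t..T, costWeight K ρ T t r *
        (compDev K ρ δ' (H.blend ht Θ hw hb hq) r - d * profile K ρ T t r) ^ 2 =
      w ^ 2 * ∫ r in t..T, costWeight K ρ T t r *
        (compDev K ρ δ Θ r - d * profile K ρ T t r) ^ 2 := by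
    rw [← intervalIntegral.integral_const_mul]
    refine intervalIntegral.integral_congr_ae (Filter.Eventually.of_forall fun r hr => ?_)
    rw [uIoc_of_le ht.2] at hr
    rw [h1 r hr]
    ring
  rw [excess, excess, h2, h3]
  ring

theorem optScale_nonneg (H : BuyingMarket K ρ T) (ht : t ∈ Icc 0 T) {x δ : ℝ} (hx : 0 ≤ x)
    (hδ : 0 ≤ δ) : 0 ≤ optScale K ρ T t δ x :=
  div_nonneg (add_nonneg hx (div_nonneg hδ (H.K_pos t ht).le)) (H.totalConst_pos ht).le

theorem optScale_mul_totalConst (H : BuyingMarket K ρ T) (ht : t ∈ Icc 0 T) (x δ : ℝ) :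
    optScale K ρ T t δ x * totalConst K ρ T t = x + δ / K t :=
  div_mul_cancel₀ _ (H.totalConst_pos ht).ne'

/-- The optimal path starts above the initial deviation exactly when the position to be built is
on or above the barrier. -/
theorem le_optScale_mul_f_iff (H : BuyingMarket K ρ T) (ht : t ∈ Icc 0 T) (x δ : ℝ) :
    δ ≤ optScale K ρ T t δ x * fFn K ρ T t ↔ δ * barrierNum K ρ T t ≤ x * fFn K ρ T t := by
  have hc := H.totalConst_pos ht
  rw [optScale, div_mul_eq_mul_div, le_div_iff₀ hc, totalConst, mul_add, add_mul, div_mul_eq_mul_div,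
    mul_div_assoc, add_le_add_iff_right]

theorem optScale_mul_f_le_iff (H : BuyingMarket K ρ T) (ht : t ∈ Icc 0 T) (x δ : ℝ) :
    optScale K ρ T t δ x * fFn K ρ T t ≤ δ ↔ x * fFn K ρ T t ≤ δ * barrierNum K ρ T t := by
  have hc := H.totalConst_pos ht
  rw [optScale, div_mul_eq_mul_div, div_le_iff₀ hc, totalConst, mul_add, add_mul, div_mul_eq_mul_div,
    mul_div_assoc, add_le_add_iff_right]

/-- The optimal strategy: jump onto the optimal path, follow it, and buy the rest at time `T`. -/
noncomputable def optimalStrategy (H : BuyingMarket K ρ T) (ht : t ∈ Icc 0 T) {x δ : ℝ}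
    (hx : 0 ≤ x) (hδ : 0 ≤ δ) (h : δ ≤ optScale K ρ T t δ x * fFn K ρ T t) : Strategy t T :=
  H.blend ht 0 (w := 0) (b := optScale K ρ T t δ x * (fFn K ρ T t / K t) - δ / K t)
    (q := (1 - 0) * optScale K ρ T t δ x) le_rfl
    (by rw [← mul_div_assoc, ← sub_div]; exact div_nonneg (sub_nonneg.2 h) (H.K_pos t ht).le)
    (by rw [sub_zero, one_mul]; exact H.optScale_nonneg ht hx hδ)

section

variable (H : BuyingMarket K ρ T) (ht : t ∈ Icc 0 T) {x δ : ℝ} (hx : 0 ≤ x) (hδ : 0 ≤ δ)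
  (h : δ ≤ optScale K ρ T t δ x * fFn K ρ T t)

theorem optimalStrategy_final : (H.optimalStrategy ht hx hδ h).final = x := by
  have := H.optScale_mul_totalConst ht x δ
  rw [totalConst] at this
  rw [optimalStrategy, blend_final]
  linear_combination this

theorem excess_optimalStrategy :
    excess K ρ δ (H.optimalStrategy ht hx hδ h) (optScale K ρ T t δ x) = 0 := by
  have hK := (H.K_pos t ht).ne'
  rw [optimalStrategy, H.excess_blend ht 0 (δ := 0) _ _ _ (by field_simp; ring)]
  ring

theorem cost_optimalStrategy : cost K ρ δ (H.optimalStrategy ht hx hδ h) =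
    optScale K ρ T t δ x ^ 2 * totalConst K ρ T t / 2 - δ ^ 2 / (2 * K t) := by
  rw [H.cost_eq_optScale ht _ hδ (H.optimalStrategy_final ht hx hδ h),
    excess_optimalStrategy, zero_div, add_zero]

theorem isOptimal_optimalStrategy : IsOptimal K ρ δ x (H.optimalStrategy ht hx hδ h) := by
  refine ⟨H.optimalStrategy_final ht hx hδ h, fun Θ hΘ => ?_⟩
  rw [cost_optimalStrategy, H.cost_eq_optScale ht Θ hδ hΘ]
  linarith [H.excess_nonneg ht Θ δ (optScale K ρ T t δ x)]

theorem eq_optimalStrategy {Θ : Strategy t T} (hΘ : IsOptimal K ρ δ x Θ) :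
    Θ = H.optimalStrategy ht hx hδ h := by
  refine H.excess_eq_zero_unique ht hδ
    (hΘ.1.trans (H.optimalStrategy_final ht hx hδ h).symm) ?_ (H.excess_optimalStrategy ht hx hδ h)
  have h1 := hΘ.2 _ (H.optimalStrategy_final ht hx hδ h)
  rw [cost_optimalStrategy, H.cost_eq_optScale ht Θ hδ hΘ.1] at h1
  linarith [H.excess_nonneg ht Θ δ (optScale K ρ T t δ x)]

theorem valueFn_eq (H : BuyingMarket K ρ T) (ht : t ∈ Icc 0 T) (hx : 0 ≤ x) (hδ : 0 ≤ δ)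
    (h : δ ≤ optScale K ρ T t δ x * fFn K ρ T t) : valueFn K ρ T t δ x =
    optScale K ρ T t δ x ^ 2 * totalConst K ρ T t / 2 - δ ^ 2 / (2 * K t) := by
  rw [← H.cost_optimalStrategy ht hx hδ h]
  have hopt := H.isOptimal_optimalStrategy ht hx hδ h
  refine IsLeast.csInf_eq ⟨⟨_, hopt.1, rfl⟩, ?_⟩
  rintro _ ⟨Θ, hΘ, rfl⟩
  exact hopt.2 Θ hΘ

end

/-! ### The barrier -/

/-- A trade moves the state along a line on which `x + δ / K_t` is constant. -/
theorem optScale_trade (H : BuyingMarket K ρ T) (ht : t ∈ Icc 0 T) (y δ ξ : ℝ) :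
    optScale K ρ T t (δ + K t * ξ) (y - ξ) = optScale K ρ T t δ y := by
  have hK := (H.K_pos t ht).ne'
  rw [optScale, optScale]
  congr 1
  field_simp
  ring

theorem mem_innerBuyRegion (H : BuyingMarket K ρ T) (ht : t ∈ Icc 0 T) {y : ℝ} (hy : 0 < y)
    (h : barrierNum K ρ T t < y * fFn K ρ T t) : y ∈ innerBuyRegion K ρ T t := by
  have hK := H.K_pos t ht
  have hb := H.barrierNum_pos ht
  have hf := H.f_nonneg ht
  have hden : 0 < fFn K ρ T t + K t * barrierNum K ρ T t :=
    add_pos_of_nonneg_of_pos hf (mul_pos hK hb)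
  -- the trade that takes the state exactly to the barrier
  set ξ := (y * fFn K ρ T t - barrierNum K ρ T t) / (fFn K ρ T t + K t * barrierNum K ρ T t)
    with hξ
  have hξ0 : 0 < ξ := div_pos (sub_pos.2 h) hden
  have hξe : ξ * (fFn K ρ T t + K t * barrierNum K ρ T t) =
      y * fFn K ρ T t - barrierNum K ρ T t := div_mul_cancel₀ _ hden.ne'
  have hξy : ξ < y := by
    rw [hξ, div_lt_iff₀ hden]
    nlinarith [mul_pos hy (mul_pos hK hb)]
  refine ⟨hy, ξ, ⟨hξ0, hξy⟩, ?_⟩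
  rw [H.valueFn_eq ht hy.le zero_le_one ((H.le_optScale_mul_f_iff ht y 1).2 (by linarith)),
    H.valueFn_eq ht (sub_nonneg.2 hξy.le) (by positivity)
      ((H.le_optScale_mul_f_iff ht _ _).2 (by linarith)), H.optScale_trade ht]
  field_simp
  ring

/-- Below or on the barrier every initial purchase is strictly suboptimal: a mixture with the
unconstrained optimum, which does not buy initially, is better by a fixed factor. -/
theorem not_mem_innerBuyRegion (H : BuyingMarket K ρ T) (ht : t ∈ Ico 0 T) {y : ℝ}
    (h : y * fFn K ρ T t ≤ barrierNum K ρ T t) : y ∉ innerBuyRegion K ρ T t := by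
  rintro ⟨hy, ξ, ⟨hξ0, hξy⟩, heq⟩
  have ht' : t ∈ Icc 0 T := Ico_subset_Icc_self ht
  have hK := H.K_pos t ht'
  set d := optScale K ρ T t 1 y with hd
  have hd0 : 0 ≤ d := H.optScale_nonneg ht' hy.le zero_le_one
  have hdtr : optScale K ρ T t (1 + K t * ξ) (y - ξ) = d := H.optScale_trade ht' y 1 ξ
  have hdf : d * fFn K ρ T t ≤ 1 := (H.optScale_mul_f_le_iff ht' y 1).2 (by linarith)
  have hδ' : 0 ≤ 1 + K t * ξ := by positivity
  obtain ⟨κ, hκ, hle⟩ := H.exists_pos_le_excess ht (d := d) hδ' (by nlinarith [mul_pos hK hξ0])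
  -- the initial trade of the unconstrained optimum is `-a`; the weight `1 - w` of this optimum in
  -- the mixture is chosen such that the two initial trades cancel
  set a := (1 - d * fFn K ρ T t) / K t with ha
  have ha0 : 0 ≤ a := div_nonneg (by linarith) hK.le
  have haK : a * K t = 1 - d * fFn K ρ T t := div_mul_cancel₀ _ hK.ne'
  set w := a / (ξ + a) with hw
  have hξa : 0 < ξ + a := by linarith
  have hw0 : 0 ≤ w := div_nonneg ha0 hξa.le
  have hw1 : w < 1 := by rw [hw, div_lt_one hξa]; linarith
  have hwe : w * (ξ + a) = a := div_mul_cancel₀ _ hξa.ne'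
  have hq : 0 ≤ (1 - w) * d := mul_nonneg (by linarith) hd0
  set A := d ^ 2 * totalConst K ρ T t / 2 - 1 / (2 * K t) with hA
  have htot := H.optScale_mul_totalConst ht' y 1
  rw [← hd, totalConst] at htot
  have haK' : a = 1 / K t - d * (fFn K ρ T t / K t) := by rw [ha]; ring
  set V := valueFn K ρ T t 1 y with hV
  -- the mixture is admissible, and its excess is `w ^ 2` times the one of `Θ` after the trade
  have hupper : ∀ Θ : Strategy t T, Θ.final = y - ξ →
      V ≤ A + w ^ 2 * excess K ρ (1 + K t * ξ) Θ d / 2 := by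
    intro Θ hΘ
    have hfin : (H.blend ht' Θ hw0 le_rfl hq).final = y := by
      rw [blend_final, hΘ]
      linear_combination (1 - w) * htot - hwe + (1 - w) * haK'
    have hex := H.excess_blend ht' Θ (δ := 1 + K t * ξ) (δ' := 1) hw0 le_rfl hq
      (by linear_combination -K t * hwe - (1 - w) * haK)
    have hc := H.cost_eq_optScale ht' (H.blend ht' Θ hw0 le_rfl hq) zero_le_one hfin
    rw [← hd, hex, one_pow, ← hA] at hc
    rw [← hc]
    exact csInf_le (H.bddBelow_cost ht' zero_le_one y) ⟨_, hfin, rfl⟩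
  have hcost : ∀ Θ : Strategy t T, Θ.final = y - ξ →
      cost K ρ (1 + K t * ξ) Θ + (1 + K t / 2 * ξ) * ξ =
        A + excess K ρ (1 + K t * ξ) Θ d / 2 := by
    intro Θ hΘ
    rw [H.cost_eq_optScale ht' Θ hδ' hΘ, hdtr, hA]
    field_simp
    ring
  obtain ⟨Θ₀, hΘ₀⟩ := Strategy.exists_final_eq ht.2.le (sub_nonneg.2 hξy.le)
  have hVA : A + κ / 2 ≤ V := by
    rw [heq, ← sub_le_iff_le_add]
    refine le_csInf ⟨_, Θ₀, hΘ₀, rfl⟩ ?_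
    rintro _ ⟨Θ, hΘ, rfl⟩
    linarith [hcost Θ hΘ, hle Θ]
  -- apply `hupper` to a strategy whose excess nearly attains the infimum
  have hw2 : w ^ 2 < 1 := by nlinarith
  have hgap : 0 < (V - A) * (1 - w ^ 2) := mul_pos (by linarith) (by linarith)
  obtain ⟨_, ⟨Θ, hΘ, rfl⟩, hlt⟩ := Real.lt_sInf_add_pos
    (s := {j | ∃ Θ : Strategy t T, Θ.final = y - ξ ∧ cost K ρ (1 + K t * ξ) Θ = j})
    ⟨_, Θ₀, hΘ₀, rfl⟩ hgap
  have h1 := hcost Θ hΘ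
  have h2 := hupper Θ hΘ
  change _ < valueFn K ρ T t (1 + K t * ξ) (y - ξ) + _ at hlt
  have h3 : excess K ρ (1 + K t * ξ) Θ d / 2 < (V - A) * (2 - w ^ 2) := by linarith
  nlinarith [mul_le_mul_of_nonneg_left h3.le (sq_nonneg w),
    mul_pos hgap (by linarith : 0 < 1 - w ^ 2)]

theorem lt_barrier_iff (H : BuyingMarket K ρ T) (ht : t ∈ Ico 0 T) {y : ℝ} :
    barrier K ρ T t < ENNReal.ofReal y ↔ barrierNum K ρ T t < y * fFn K ρ T t := by
  have hb := H.barrierNum_pos (Ico_subset_Icc_self ht)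
  have hf := H.f_nonneg (Ico_subset_Icc_self ht)
  rw [barrier, if_pos ht.2]
  rcases hf.eq_or_lt with hf | hf
  · rw [← hf, ENNReal.ofReal_zero, ENNReal.div_zero (ENNReal.ofReal_pos.2 hb).ne', mul_zero]
    simp [hb.le]
  · rw [← ENNReal.ofReal_div_of_pos hf, ENNReal.ofReal_lt_ofReal_iff', div_lt_iff₀ hf]
    exact ⟨fun h => h.1, fun h => ⟨h, by by_contra! hy; nlinarith⟩⟩

theorem isBarrierFn (H : BuyingMarket K ρ T) : IsBarrierFn K ρ T (barrier K ρ T) := by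
  intro t ht
  ext y
  rcases ht.2.eq_or_lt with rfl | htT
  · rw [mem_ofPred_eq, barrier, if_neg (lt_irrefl _), ENNReal.ofReal_pos]
    refine ⟨fun h => h.1, fun hy => ⟨hy, y / 2, ⟨by linarith, by linarith⟩, ?_⟩⟩
    have hK := H.K_pos t ht
    rw [H.valueFn_terminal zero_le_one hy.le, H.valueFn_terminal (by positivity) (by linarith)]
    ring
  · have ht' : t ∈ Ico 0 T := ⟨ht.1, htT⟩
    rw [mem_ofPred_eq, H.lt_barrier_iff ht']
    constructor
    · intro h
      by_contra hcon
      exact H.not_mem_innerBuyRegion ht' (not_lt.1 hcon) h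
    · intro h
      refine H.mem_innerBuyRegion ht ?_ h
      by_contra! hy
      nlinarith [H.barrierNum_pos ht, H.f_nonneg ht]

theorem mul_barrierNum_le (H : BuyingMarket K ρ T) {x δ : ℝ} (hx : 0 ≤ x)
    (h : ENNReal.ofReal δ ≤ ENNReal.ofReal x / barrier K ρ T 0) :
    δ * barrierNum K ρ T 0 ≤ x * fFn K ρ T 0 := by
  have h0 : (0 : ℝ) ∈ Icc 0 T := ⟨le_rfl, H.pos.le⟩
  have hb := H.barrierNum_pos h0
  rw [barrier, if_pos H.pos] at h
  rcases (H.f_nonneg h0).eq_or_lt with hf | hf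
  · rw [← hf, ENNReal.ofReal_zero, ENNReal.div_zero (ENNReal.ofReal_pos.2 hb).ne',
      ENNReal.div_top, nonpos_iff_eq_zero, ENNReal.ofReal_eq_zero] at h
    rw [← hf]
    nlinarith
  · rw [← ENNReal.ofReal_div_of_pos hf, ← ENNReal.ofReal_div_of_pos (div_pos hb hf),
      ENNReal.ofReal_le_ofReal_iff (div_nonneg hx (div_pos hb hf).le), le_div_iff₀ (div_pos hb hf),
      ← mul_div_assoc, div_le_iff₀ hf] at h
    exact h

end BuyingMarket

end OptimalExecution

theorem mainTheorem9 (T : ℝ) (hT : 0 < T) (K ρ : ℝ → ℝ)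
    (hKpos : ∀ t ∈ Icc 0 T, 0 < K t) (hρpos : ∀ t ∈ Icc 0 T, 0 < ρ t)
    (hK : ContDiffOn ℝ 2 K (Icc 0 T)) (hρ : ContDiffOn ℝ 1 ρ (Icc 0 T))
    (h1 : ∀ t ∈ Icc 0 T, 0 < dI T K t + 2 * ρ t * K t)
    (h2 : 0 ≤ fFn K ρ T 0)
    (h3 : ∀ t ∈ Icc 0 T, 0 ≤ dI T (fFn K ρ T) t + ρ t * fFn K ρ T t) :
    ((∀ t ∈ Ico 0 T, 0 ≤ fFn K ρ T t ∧ 0 < barrierNum K ρ T t) ∧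
      IsBarrierFn K ρ T (barrier K ρ T)) ∧
    0 < normConst K ρ T ∧
    ∀ x δ : ℝ, 0 ≤ x → 0 ≤ δ →
      ENNReal.ofReal δ ≤ ENNReal.ofReal x / barrier K ρ T 0 →
      (∃! Θ : Strategy 0 T, IsOptimal K ρ δ x Θ) ∧
      (∀ Θ : Strategy 0 T, IsOptimal K ρ δ x Θ →
        Θ.jump 0 = deltaStar K ρ T δ x * (fFn K ρ T 0 / K 0) - δ / K 0 ∧
        (∀ s ∈ Ioc 0 T, Θ s = Θ.jump 0 + ∫ t in (0 : ℝ)..s, deltaStar K ρ T δ x * rate K ρ T t) ∧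
        Θ.jump T = deltaStar K ρ T δ x * ((1 - fFn K ρ T T) / K T)) ∧
      valueFn K ρ T 0 δ x =
        deltaStar K ρ T δ x ^ 2 *
            ((∫ t in (0 : ℝ)..T,
                (dI T K t + 2 * ρ t * K t) * (fFn K ρ T t ^ 2 / (2 * K t ^ 2))) +
              1 / (2 * K T)) -
          δ ^ 2 / (2 * K 0) := by
  have H : BuyingMarket K ρ T := ⟨⟨hT, hKpos, hρpos, hK, hρ, h1⟩, h2, h3⟩
  have h0 : (0 : ℝ) ∈ Icc 0 T := ⟨le_rfl, hT.le⟩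
  have hTT : T ∈ Ioc 0 T := ⟨hT, le_rfl⟩
  have hnorm : normConst K ρ T = totalConst K ρ T 0 := by
    rw [normConst, totalConst, barrierNum]; ring
  refine ⟨⟨fun t ht => ⟨H.f_nonneg (Ico_subset_Icc_self ht),
    H.barrierNum_pos (Ico_subset_Icc_self ht)⟩, H.isBarrierFn⟩,
    hnorm ▸ H.totalConst_pos h0, fun x δ hx hδ hle => ?_⟩
  have hscale : deltaStar K ρ T δ x = optScale K ρ T 0 δ x := by
    rw [deltaStar, optScale, hnorm]; ring
  have h := (H.le_optScale_mul_f_iff h0 x δ).2 (H.mul_barrierNum_le hx hle)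
  refine ⟨⟨_, H.isOptimal_optimalStrategy h0 hx hδ h,
    fun Θ hΘ => H.eq_optimalStrategy h0 hx hδ h hΘ⟩, fun Θ hΘ => ?_, ?_⟩
  · rw [hscale]
    have hΘf := hΘ.1
    obtain rfl := H.eq_optimalStrategy h0 hx hδ h hΘ
    have hjump : (H.optimalStrategy h0 hx hδ h).jump 0 =
        optScale K ρ T 0 δ x * (fFn K ρ T 0 / K 0) - δ / K 0 := by
      rw [Strategy.jump, Strategy.eq_zero' _ 0 le_rfl, sub_zero]
      rw [BuyingMarket.optimalStrategy, BuyingMarket.blend,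
        Strategy.rightLim_combine_zero _ _ _ _ _ _ _ _ hT rfl]
    have happly : ∀ s ∈ Ioc 0 T, H.optimalStrategy h0 hx hδ h s =
        optScale K ρ T 0 δ x * (fFn K ρ T 0 / K 0) - δ / K 0 +
          ∫ t in (0 : ℝ)..s, optScale K ρ T 0 δ x * rate K ρ T t := fun s hs => by
      rw [BuyingMarket.optimalStrategy, BuyingMarket.blend,
        Strategy.combine_apply _ _ _ _ _ _ _ _ hs, intervalIntegral.integral_const_mul]
      ring
    refine ⟨hjump, fun s hs => by rw [hjump, happly s hs], ?_⟩
    have htot := H.optScale_mul_totalConst h0 x δ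
    rw [totalConst, barrierNum] at htot
    rw [Strategy.jump, ← Strategy.final, hΘf, happly T hTT, intervalIntegral.integral_const_mul]
    linear_combination -htot
  · rw [H.valueFn_eq h0 hx hδ h, hscale, H.totalConst_eq h0]
    have : ∫ t in (0 : ℝ)..T, costWeight K ρ T 0 t * profile K ρ T 0 t ^ 2 =
        2 * ∫ t in (0 : ℝ)..T, (dI T K t + 2 * ρ t * K t) * (fFn K ρ T t ^ 2 / (2 * K t ^ 2)) := by
      rw [← intervalIntegral.integral_const_mul]
      refine intervalIntegral.integral_congr fun s hs => ?_
      rw [uIcc_of_le hT.le] at hs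
      simp only [H.costWeight_mul_profile_sq h0 hs]
      ring
    rw [this]
    ring
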